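/- Let $F:\mathbb R\to[0,1]$ be a cumulative distribution function which is positive everywhere and Lipschitz. Let $p,q\ge 0$ be integers, $\alpha_1,\dots,\alpha_p,\beta_1,\dots,\beta_q\in\mathbb R$ and $\gamma\in\mathbb R^d$, and assume that every complex root $z$ of the polynomial $1-\sum_{j=1}^q\beta_jz^j$ satisfies $|z|>1$. Let $X=(X_t)_{t\in\mathbb Z}$ be a stationary and ergodic process with values in $\mathbb R^d$, defined on a probability space $(\Omega_0,P_0)$, with $\mathbb E\log_+|X_1|<\infty$. A solution of the model consists of processes $(X'_t,Y_t,\mu_t)_{t\in\mathbb Z}$ on some probability space, with $X'=(X'_t)_{t\in\mathbb Z}$ distributed as $X$, $Y_t\in\{0,1\}$ and $\mu_t\in\mathbb R$, such that almost surely, for all $t\in\mathbb Z$, $$\mathbb P\left(Y_t=1\mid Y_{t-1},Y_{t-2},\dots;X'\right)=F(\mu_t),\qquad \mu_t=\sum_{j=1}^q\beta_j\mu_{t-j}+\sum_{k=1}^p\alpha_kY_{t-k}+\gamma'X'_t.$$ Then the model has a unique stationary solution, in the following sense. There is a solution, defined on the enlargement $\{0,1\}^{\mathbb Z}\times\Omega_0$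 of $(\Omega_0,P_0)$ (with a probability measure whose marginal on $\Omega_0$ is $P_0$, with $Y$ the coordinate process on $\{0,1\}^{\mathbb Z}$ and $X'=X$ read on the second factor), such that $((Y_t,X'_t,\mu_t))_{t\in\mathbb Z}$ is stationary and $((Y_t,X'_t))_{t\in\mathbb Z}$ is stationary and ergodic. Every solution, on any probability space, for which the process $((Y_t,X'_t))_{t\in\mathbb Z}$ is stationary has the same law of $((Y_t,X'_t))_{t\in\mathbb Z}$ as this one; and every solution for which the process $(\mu_t)_{t\in\mathbb Z}$ is stationary has the same law of $((Y_t,X'_t,\mu_t))_{t\in\mathbb Z}$ as this one. In particular, for every such solution the process $((Y_t,X'_t))_{t\in\mathbb Z}$ is stationary and ergodic. -/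

import Mathlib

open MeasureTheory ProbabilityTheory

universe u v

namespace BinaryAutoregression

/-- The time shift `(x_t)_t ↦ (x_{t+1})_t` on two-sided sequences. -/
def shift {S : Type*} (x : ℤ → S) : ℤ → S := fun t => x (t + 1)

/-- The law of a process `(V_t)_{t ∈ ℤ}` on the space of two-sided sequences
(with the product σ-algebra). -/
noncomputable def law {Ω S : Type*} [MeasurableSpace Ω] [MeasurableSpace S]
    (P : Measure Ω) (V : ℤ → Ω → S) : Measure (ℤ → S) :=
  P.map (fun ω t => V t ω)

/-- Strict stationarity: the law of the whole process is invariant under the time shift. -/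
def IsStationary {Ω S : Type*} [MeasurableSpace Ω] [MeasurableSpace S]
    (P : Measure Ω) (V : ℤ → Ω → S) : Prop :=
  (∀ t, Measurable (V t)) ∧ MeasurePreserving shift (law P V) (law P V)

/-- A stationary and ergodic process: the law of the process is invariant under the time shift,
and every shift-invariant event has probability `0` or `1`. -/
def IsStationaryErgodic {Ω S : Type*} [MeasurableSpace Ω] [MeasurableSpace S]
    (P : Measure Ω) (V : ℤ → Ω → S) : Prop :=
  (∀ t, Measurable (V t)) ∧ Ergodic shift (law P V)

/-- The σ-algebra generated by the past values `Y_{t-1}, Y_{t-2}, …` and by the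
whole covariate process `X = (X_s)_{s ∈ ℤ}`. -/
@[reducible] def pastAndCovariates {Ω S S' : Type*} [MeasurableSpace S] [MeasurableSpace S']
    (Y : ℤ → Ω → S) (X : ℤ → Ω → S') (t : ℤ) : MeasurableSpace Ω :=
  (⨆ s : {s : ℤ // s < t}, MeasurableSpace.comap (Y s) inferInstance) ⊔
    ⨆ s : ℤ, MeasurableSpace.comap (X s) inferInstance

/-- On the probability space `(Ω, P)`, the `{0, 1}`-valued process `Y` with latent process `μ` solves
`P(Y_t = 1 | Y_{t-1}, Y_{t-2}, …; X) = F(μ_t)`,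
`μ_t = ∑_{j=1}^q β_j μ_{t-j} + ∑_{k=1}^p α_k Y_{t-k} + γ' X_t`, for all `t ∈ ℤ`. -/
structure IsSolution {d : ℕ} (F : ℝ → ℝ) (q p : ℕ) (β α : ℕ → ℝ) (γ : EuclideanSpace ℝ (Fin d))
    {Ω : Type*} [MeasurableSpace Ω] (P : Measure Ω)
    (X : ℤ → Ω → EuclideanSpace ℝ (Fin d)) (Y : ℤ → Ω → Fin 2) (μ : ℤ → Ω → ℝ) : Prop where
  measurable_covariate : ∀ t, Measurable (X t)
  measurable_response : ∀ t, Measurable (Y t)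
  measurable_latent : ∀ t, Measurable (μ t)
  recursion : ∀ t, ∀ᵐ ω ∂P,
    μ t ω = ∑ j ∈ Finset.Icc 1 q, β j * μ (t - (j : ℤ)) ω
      + ∑ k ∈ Finset.Icc 1 p, α k * ((Y (t - (k : ℤ)) ω : ℕ) : ℝ)
      + inner ℝ γ (X t ω)
  condProb : ∀ t,
    P[Set.indicator {ω | Y t ω = 1} (fun _ => (1 : ℝ)) | pastAndCovariates Y X t]
      =ᵐ[P] fun ω => F (μ t ω)

end BinaryAutoregression

open Filter Topology

/-! Freezing the covariate path `x` turns the model into a binary chain with infinite memory, whose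
probability of the value `1` at time `t` is `F (latent … t y x)`. The root condition makes the
powers of the companion matrix decay geometrically (`exists_companion_pow_le`), so the recursion is
solved by a causal filter. The logarithmic moment makes the filter converge for almost every path
(`ae_tame`), and its dependence on responses at distance `k` decays like `√ρ ^ k`, uniformly in the
path (`Tame.osc_latent`).

Two pasts of the chain can be coupled. If they agree on `m` consecutive times, with `m` so large
that the remaining moduli of continuity sum to at most `1/2`, they separate later with probability
at most `1/2`. Agreement is created on windows of length `m` where the probability of a `1` is at
least some `δ > 0`; positivity of `F` and Poincaré recurrence provide such windows arbitrarily far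
back, with the same `δ` (`ae_frequently_window`). Each window used contracts oscillations by the
factor `1 - δ ^ m / 4`, so the remote past is forgotten (`back_osc_tendsto`, `ae_forgets`).

Forgetting determines the joint law from the law of the environment (`IsCompatible.unique`).
Existence comes from compactness of the probability measures on `{0,1}^ℤ`, and forgetting makes the
chosen measure measurable in the environment (`exists_compatible_kernel`). Stationarity holds
because the shifted law is compatible too. For ergodicity, conditioning on an invariant event
preserves compatibility (`IsCompatible.cond_invariant`) and, by ergodicity of the environment, its
marginal; uniqueness then forces the event to have probability one.

For an arbitrary solution, `μ - latent` solves the homogeneous recursion and so dies out forwards in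
time. If `(Y, X')` is stationary, passing to time `+∞` yields compatibility
(`isCompatible_of_stationary`). If `μ` is stationary, tightness in the remote past forces `μ =
latent` (`IsSolution.latent_eq_of_stationary`), and compatibility follows. -/

namespace BinaryAutoregression

/-! ### Linear recursions and the companion matrix. -/

/-- The companion matrix of the recursion `s_t = ∑_{j=1}^q β_j s_{t-j}`, acting on the state
`(s_t, …, s_{t-q})`. -/
def companion (q : ℕ) (β : ℕ → ℝ) : Matrix (Fin (q + 1)) (Fin (q + 1)) ℝ :=
  Matrix.of fun i j => if i = 0 then (if (j : ℕ) < q then β (j + 1) else 0)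
    else if (i : ℕ) = j + 1 then 1 else 0

section

variable {R : Type*} [Semiring R] (q : ℕ) (β : ℕ → ℝ)

lemma sum_companion_zero (φ : ℝ →+* R) (v : Fin (q + 1) → R) :
    ∑ j, φ (companion q β 0 j) * v j = ∑ j : Fin q, φ (β (j + 1)) * v j.castSucc := by
  rw [Fin.sum_univ_castSucc]
  simp [companion]

lemma sum_companion_succ (φ : ℝ →+* R) (v : Fin (q + 1) → R) (i : Fin q) :
    ∑ j, φ (companion q β i.succ j) * v j = v i.castSucc := by
  rw [Finset.sum_eq_single i.castSucc]
  · simp [companion]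
  · intro j _ hj
    have : ¬ ((i : ℕ) = j) := fun h => hj (Fin.ext (by simp [h]))
    simp [companion, this]
  · simp

end

lemma sum_Icc_eq_sum_fin (q : ℕ) {M : Type*} [AddCommMonoid M] (f : ℕ → M) :
    ∑ j ∈ Finset.Icc 1 q, f j = ∑ j : Fin q, f (j + 1) := by
  rw [Fin.sum_univ_eq_sum_range (fun j => f (j + 1)) q, Finset.range_eq_Ico,
    Finset.sum_Ico_add' f 0 q 1]
  rfl

section

attribute [local instance] Matrix.linftyOpNormedAddCommGroup Matrix.linftyOpNormedRing
  Matrix.linftyOpNormedAlgebra Matrix.linftyOpNormedSpace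

/-- For a nonzero eigenvalue `k` the subdiagonal rows force `v i = k⁻ⁱ v 0`, and the top row then
says that `k⁻¹` is a root of the polynomial. The padded last column, which keeps the matrix nonempty
when `q = 0`, only contributes the eigenvalue `0`. -/
lemma companion_eigenvalue_lt_one {q : ℕ} {β : ℕ → ℝ}
    (hβ : ∀ z : ℂ, 1 - ∑ j ∈ Finset.Icc 1 q, (β j : ℂ) * z ^ j = 0 → 1 < ‖z‖) {k : ℂ}
    (hk : k ∈ spectrum ℂ ((companion q β).map Complex.ofRealHom)) : ‖k‖ < 1 := by
  rw [← Matrix.spectrum_toLin', ← Module.End.hasEigenvalue_iff_mem_spectrum] at hk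
  obtain ⟨v, hv⟩ := hk.exists_hasEigenvector
  have hv0 := hv.2
  have heq := hv.apply_eq_smul
  by_cases hk0 : k = 0
  · simp [hk0]
  have hrow : ∀ i, ∑ j, Complex.ofRealHom (companion q β i j) * v j = k * v i := by
    intro i
    have := congrFun heq i
    simpa [Matrix.toLin'_apply, Matrix.mulVec, dotProduct] using this
  have hsucc : ∀ i : Fin q, v i.castSucc = k * v i.succ := fun i => by
    rw [← hrow, sum_companion_succ]
  have hpow : ∀ i : Fin (q + 1), k ^ (i : ℕ) * v i = v 0 := by
    intro i
    induction i using Fin.induction with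
    | zero => simp
    | succ i ih =>
      rw [← ih, hsucc]
      simp [pow_succ, mul_assoc]
  have hv00 : v 0 ≠ 0 := by
    intro h
    apply hv0
    funext i
    have := hpow i
    rw [h] at this
    simpa [hk0] using this
  have h0 := hrow 0
  rw [sum_companion_zero] at h0
  have hroot : 1 - ∑ j ∈ Finset.Icc 1 q, (β j : ℂ) * (k⁻¹) ^ j = 0 := by
    rw [sum_Icc_eq_sum_fin, sub_eq_zero]
    have hterm : ∀ j : Fin q, Complex.ofRealHom (β (j + 1)) * v j.castSucc
        = ((β (j + 1) : ℂ) * (k⁻¹) ^ ((j : ℕ) + 1)) * (k * v 0) := by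
      intro j
      have := hpow j.castSucc
      rw [← this]
      simp only [Fin.val_castSucc, Complex.ofRealHom_eq_coe, inv_pow]
      field_simp
      ring
    simp_rw [hterm] at h0
    rw [← Finset.sum_mul] at h0
    have hne : k * v 0 ≠ 0 := mul_ne_zero hk0 hv00
    exact (mul_right_cancel₀ hne (by rw [one_mul, h0])).symm
  have := hβ _ hroot
  rw [norm_inv] at this
  have hpos : 0 < ‖k‖ := norm_pos_iff.2 hk0
  by_contra hcon
  exact absurd this (not_lt.2 (inv_le_one_of_one_le₀ (not_lt.1 hcon)))

/-- If all roots of `1 - ∑ β_j z^j` lie outside the closed unit disc, then the powers of the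
companion matrix decay geometrically. -/
theorem exists_companion_pow_le {q : ℕ} {β : ℕ → ℝ}
    (hβ : ∀ z : ℂ, 1 - ∑ j ∈ Finset.Icc 1 q, (β j : ℂ) * z ^ j = 0 → 1 < ‖z‖) :
    ∃ C ρ : ℝ, 0 ≤ C ∧ 0 < ρ ∧ ρ < 1 ∧ ∀ n i j, |(companion q β ^ n) i j| ≤ C * ρ ^ n := by
  set A := (companion q β).map Complex.ofRealHom with hA
  have : CompleteSpace (Matrix (Fin (q + 1)) (Fin (q + 1)) ℂ) := FiniteDimensional.complete ℂ _
  have hlt : spectralRadius ℂ A < (1 : NNReal) :=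
    spectrum.spectralRadius_lt_of_forall_lt A fun k hk => by
      have := companion_eigenvalue_lt_one hβ hk
      exact_mod_cast this
  -- Gelfand's formula gives `‖A ^ n‖ ≤ ρ ^ n` from some rank on for any `ρ` strictly above the
  -- spectral radius. Strictness also makes `ρ` positive, so that `C` can absorb the first powers
  -- divided by `ρ ^ n`.
  obtain ⟨ρ, hρ1, hρ2⟩ := ENNReal.lt_iff_exists_nnreal_btwn.1 hlt
  have hρ2' : (ρ : ℝ) < 1 := by exact_mod_cast hρ2
  have hρ0 : 0 < ρ := by
    have : (0 : ENNReal) < ρ := lt_of_le_of_lt (by simp) hρ1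
    exact_mod_cast this
  have hev := (spectrum.pow_nnnorm_pow_one_div_tendsto_nhds_spectralRadius A).eventually
    (gt_mem_nhds hρ1)
  obtain ⟨n₀, hn₀⟩ := eventually_atTop.1 (hev.and (eventually_gt_atTop 0))
  have hbig : ∀ n ≥ n₀, ‖A ^ n‖ ≤ (ρ : ℝ) ^ n := by
    intro n hn
    obtain ⟨h1, h2⟩ := hn₀ n hn
    have hn' : (n : ℝ) ≠ 0 := by positivity
    have h3 : ((‖A ^ n‖₊ : ENNReal) ^ (1 / n : ℝ)) ^ (n : ℝ) ≤ (ρ : ENNReal) ^ (n : ℝ) :=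
      ENNReal.rpow_le_rpow h1.le (by positivity)
    rw [← ENNReal.rpow_mul, one_div_mul_cancel hn', ENNReal.rpow_one, ENNReal.rpow_natCast] at h3
    exact_mod_cast h3
  set C : ℝ := 1 + ∑ n ∈ Finset.range n₀, ‖A ^ n‖ / (ρ : ℝ) ^ n with hC
  have hρ0' : (0 : ℝ) < ρ := by exact_mod_cast hρ0
  have hnn : ∀ n ∈ Finset.range n₀, 0 ≤ ‖A ^ n‖ / (ρ : ℝ) ^ n := fun n _ => by positivity
  have hC1 : 1 ≤ C := by linarith [Finset.sum_nonneg hnn]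
  have hall : ∀ n, ‖A ^ n‖ ≤ C * (ρ : ℝ) ^ n := by
    intro n
    have hp : 0 < (ρ : ℝ) ^ n := pow_pos hρ0' n
    by_cases hn : n₀ ≤ n
    · exact (hbig n hn).trans (le_mul_of_one_le_left hp.le hC1)
    · have := Finset.single_le_sum hnn (Finset.mem_range.2 (not_le.1 hn))
      rw [← div_le_iff₀ hp]
      linarith
  refine ⟨C, ρ, by linarith, hρ0', hρ2', fun n i j => (le_trans ?_ (hall n))⟩
  have hmap : A ^ n = (companion q β ^ n).map Complex.ofRealHom := by
    rw [hA, ← RingHom.mapMatrix_apply, ← RingHom.mapMatrix_apply, map_pow]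
  have hentry : ‖(A ^ n) i j‖ ≤ ‖A ^ n‖ := by
    rw [← coe_nnnorm, ← coe_nnnorm, Matrix.linfty_opNNNorm_def, NNReal.coe_le_coe]
    exact (Finset.single_le_sum (f := fun j => ‖(A ^ n) i j‖₊) (fun _ _ => zero_le)
      (Finset.mem_univ j)).trans (Finset.le_sup (f := fun i => ∑ j, ‖(A ^ n) i j‖₊)
        (Finset.mem_univ i))
  rw [hmap] at hentry
  rw [hmap]
  simpa using hentry

end

/-- A solution of the homogeneous recursion is controlled by its remote past. -/
lemma homogeneous_bound {q : ℕ} {β : ℕ → ℝ} {C ρ : ℝ}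
    (hM : ∀ n i j, |(companion q β ^ n) i j| ≤ C * ρ ^ n) {h : ℤ → ℝ}
    (hh : ∀ t, h t = ∑ j ∈ Finset.Icc 1 q, β j * h (t - (j : ℤ))) (t : ℤ) (n : ℕ) :
    |h t| ≤ C * ρ ^ n * ∑ j : Fin (q + 1), |h (t - n - (j : ℕ))| := by
  have hstep : ∀ t : ℤ, (fun i : Fin (q + 1) => h (t - (i : ℕ)))
      = (companion q β).mulVec (fun i : Fin (q + 1) => h (t - 1 - (i : ℕ))) := by
    intro t
    funext i
    rcases Fin.eq_zero_or_eq_succ i with rfl | ⟨i, rfl⟩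
    · have := sum_companion_zero q β (RingHom.id ℝ) (fun i : Fin (q + 1) => h (t - 1 - (i : ℕ)))
      simp only [RingHom.id_apply] at this
      rw [Matrix.mulVec, dotProduct, this]
      simp only [Fin.val_zero, Nat.cast_zero, sub_zero, Fin.val_castSucc]
      rw [hh t, sum_Icc_eq_sum_fin]
      refine Finset.sum_congr rfl fun j _ => ?_
      congr 2
      push_cast
      ring
    · have := sum_companion_succ q β (RingHom.id ℝ)
        (fun i : Fin (q + 1) => h (t - 1 - (i : ℕ))) i
      simp only [RingHom.id_apply] at this
      rw [Matrix.mulVec, dotProduct, this]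
      simp only [Fin.val_succ, Fin.val_castSucc]
      congr 1
      push_cast
      ring
  have hiter : ∀ n : ℕ, (fun i : Fin (q + 1) => h (t - (i : ℕ)))
      = (companion q β ^ n).mulVec (fun i : Fin (q + 1) => h (t - n - (i : ℕ))) := by
    intro n
    induction n with
    | zero => simp
    | succ n ih =>
      rw [ih, hstep (t - n), Matrix.mulVec_mulVec, ← pow_succ]
      congr 1
      funext i
      congr 1
      push_cast
      ring
  have h0 := congrFun (hiter n) 0
  simp only [Fin.val_zero, Nat.cast_zero, sub_zero] at h0
  rw [h0, Matrix.mulVec, dotProduct, Finset.mul_sum]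
  refine (Finset.abs_sum_le_sum_abs _ _).trans (Finset.sum_le_sum fun j _ => ?_)
  rw [abs_mul]
  exact mul_le_mul_of_nonneg_right (hM n 0 j) (abs_nonneg _)

/-- The coefficients of the power series `1 / (1 - ∑_{j=1}^q β_j z^j)`. -/
def impulse (q : ℕ) (β : ℕ → ℝ) (n : ℕ) : ℝ := (companion q β ^ n) 0 0

/-- The causal linear filter solves the autoregressive recursion. -/
lemma impulse_recursion {q : ℕ} {β : ℕ → ℝ} {C ρ : ℝ}
    (hM : ∀ n i j, |(companion q β ^ n) i j| ≤ C * ρ ^ n) {u : ℤ → ℝ}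
    (hu : ∀ t, Summable fun n : ℕ => ρ ^ n * |u (t - n)|) (t : ℤ) :
    ∑' n : ℕ, impulse q β n * u (t - n)
      = ∑ j ∈ Finset.Icc 1 q, β j * ∑' n : ℕ, impulse q β n * u (t - (j : ℤ) - n) + u t := by
  set M := companion q β
  have hs : ∀ t i, Summable fun n : ℕ => (M ^ n) i 0 * u (t - n) := fun t i =>
    Summable.of_norm_bounded ((hu t).mul_left C) fun n => by
      rw [Real.norm_eq_abs, abs_mul, ← mul_assoc]
      exact mul_le_mul_of_nonneg_right (hM n i 0) (abs_nonneg _)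
  have hshift : ∀ (t : ℤ) (n : ℕ), u (t - (n + 1 : ℕ)) = u (t - 1 - n) := fun t n => by
    congr 1; push_cast; ring
  have hsucc : ∀ (i : Fin q) (t : ℤ),
      ∑' n : ℕ, (M ^ n) i.succ 0 * u (t - n) = ∑' n : ℕ, (M ^ n) i.castSucc 0 * u (t - 1 - n) := by
    intro i t
    rw [(hs t i.succ).tsum_eq_zero_add]
    simp only [pow_zero, Matrix.one_apply_ne (Fin.succ_ne_zero i), zero_mul, zero_add]
    refine tsum_congr fun n => ?_
    rw [hshift, pow_succ', Matrix.mul_apply]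
    have := sum_companion_succ q β (RingHom.id ℝ) (fun j => (M ^ n) j 0) i
    simp only [RingHom.id_apply] at this
    rw [this]
  -- Coordinate `i` of the filtered state is coordinate `0` delayed by `i`; the top row of the
  -- matrix then closes the recursion.
  have hdelay : ∀ (i : Fin (q + 1)) (t : ℤ),
      ∑' n : ℕ, (M ^ n) i 0 * u (t - n) = ∑' n : ℕ, (M ^ n) 0 0 * u (t - (i : ℕ) - n) := by
    intro i
    induction i using Fin.induction with
    | zero => simp
    | succ i ih =>
      intro t
      rw [hsucc, ih]
      refine tsum_congr fun n => ?_
      congr 2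
      simp only [Fin.val_succ, Fin.val_castSucc]
      push_cast
      ring
  have h0 : ∀ n : ℕ, (M ^ (n + 1)) 0 0 * u (t - (n + 1 : ℕ))
      = ∑ j : Fin q, β (j + 1) * ((M ^ n) j.castSucc 0 * u (t - 1 - n)) := by
    intro n
    rw [hshift, pow_succ', Matrix.mul_apply]
    have := sum_companion_zero q β (RingHom.id ℝ) (fun j => (M ^ n) j 0)
    simp only [RingHom.id_apply] at this
    rw [this, Finset.sum_mul]
    exact Finset.sum_congr rfl fun _ _ => by ring
  have hmain := (hs t 0).tsum_eq_zero_add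
  simp only [h0] at hmain
  rw [Summable.tsum_finsetSum fun j _ => ((hs (t - 1) _).mul_left _)] at hmain
  unfold impulse
  rw [hmain, sum_Icc_eq_sum_fin, add_comm]
  congr 1
  · refine Finset.sum_congr rfl fun j _ => ?_
    rw [tsum_mul_left, hdelay]
    congr 1
    refine tsum_congr fun n => ?_
    congr 2
    simp only [Fin.val_castSucc]
    push_cast
    ring
  · simp

/-! ### Loss of memory for chains with infinite memory. -/

/-- Averages `f` over the value at time `t`, which is `1` with probability `g`. -/
def step (g : (ℤ → Fin 2) → ℝ) (t : ℤ) (f : (ℤ → Fin 2) → ℝ) (y : ℤ → Fin 2) : ℝ :=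
  g y * f (Function.update y t 1) + (1 - g y) * f (Function.update y t 0)

/-- Averages `f` successively over the values at the times `N - 1, …, N - n`. -/
def back (g : ℤ → (ℤ → Fin 2) → ℝ) (N : ℤ) : ℕ → ((ℤ → Fin 2) → ℝ) → (ℤ → Fin 2) → ℝ
  | 0, f => f
  | n + 1, f => step (g (N - (n + 1))) (N - (n + 1)) (back g N n f)

/-- The oscillation of `f` over sequences that agree on `[t - k, t)` is at most `v`. -/
def OscLE (f : (ℤ → Fin 2) → ℝ) (t : ℤ) (k : ℕ) (v : ℝ) : Prop :=
  ∀ y y' : ℤ → Fin 2, (∀ r, t - k ≤ r → r < t → y r = y' r) → |f y - f y'| ≤ v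

/-- Transition probabilities with values in `[0, 1]` and with modulus of continuity `b`. -/
structure IsTransition (g : ℤ → (ℤ → Fin 2) → ℝ) (b : ℕ → ℝ) : Prop where
  nonneg : ∀ t y, 0 ≤ g t y
  le_one : ∀ t y, g t y ≤ 1
  osc : ∀ t k, OscLE (g t) t k (b k)

lemma OscLE.mono {f : (ℤ → Fin 2) → ℝ} {t : ℤ} {k k' : ℕ} {v v' : ℝ} (h : OscLE f t k v)
    (hk : k ≤ k') (hv : v ≤ v') : OscLE f t k' v' := fun y y' hy =>
  (h y y' fun r h1 h2 => hy r (by omega) h2).trans hv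

lemma OscLE.nonneg {f : (ℤ → Fin 2) → ℝ} {t : ℤ} {k : ℕ} {v : ℝ} (h : OscLE f t k v) : 0 ≤ v :=
  (abs_nonneg _).trans (h 0 0 fun _ _ _ => rfl)

lemma agree_update {y y' : ℤ → Fin 2} {t : ℤ} {k : ℕ}
    (hy : ∀ r, t - k ≤ r → r < t → y r = y' r) (i : Fin 2) :
    ∀ r, t + 1 - (k + 1 : ℕ) ≤ r → r < t + 1 →
      Function.update y t i r = Function.update y' t i r := by
  intro r h1 h2
  by_cases h : r = t
  · simp [h]
  · simp only [Function.update_of_ne h]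
    exact hy r (by push_cast at h1; omega) (by omega)

/-- Giving both pasts the same drawn value, with weights from `g y`, costs `v`; replacing `g y` by
`g y'` costs at most `b` times the total oscillation. A bound `OscLE f (t + 1) 0 w` is one on the
total oscillation, since its window is empty. -/
lemma OscLE.step {g f : (ℤ → Fin 2) → ℝ} {t : ℤ} {k : ℕ} {b v w : ℝ}
    (h0 : ∀ y, 0 ≤ g y) (h1 : ∀ y, g y ≤ 1) (hg : OscLE g t k b)
    (hv : OscLE f (t + 1) (k + 1) v) (hw : OscLE f (t + 1) 0 w) :
    OscLE (step g t f) t k (v + b * w) := by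
  intro y y' hy
  have e1 := abs_le.1 (hv _ _ (agree_update hy 1))
  have e0 := abs_le.1 (hv _ _ (agree_update hy 0))
  have ew := hw (Function.update y' t 1) (Function.update y' t 0) (by intro r; omega)
  have eg := hg y y' hy
  have hb : |(g y - g y') * (f (Function.update y' t 1) - f (Function.update y' t 0))| ≤ b * w := by
    rw [abs_mul]
    exact mul_le_mul eg ew (abs_nonneg _) hg.nonneg
  have := abs_le.1 hb
  unfold BinaryAutoregression.step
  rw [abs_le]
  constructor <;> nlinarith [h0 y, h1 y]

/-- In a maximal coupling of the two draws, mass `η` makes both equal to `1` and lengthens the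
agreement by one time; the rest costs at most the total oscillation. The case `η = 0` shows that
averaging never increases the total oscillation. -/
lemma OscLE.step_doeblin {g f : (ℤ → Fin 2) → ℝ} {t : ℤ} {k : ℕ} {η v w : ℝ}
    (hη : 0 ≤ η) (h0 : ∀ y, η ≤ g y) (h1 : ∀ y, g y ≤ 1)
    (hv : OscLE f (t + 1) (k + 1) v) (hw : OscLE f (t + 1) 0 w) :
    OscLE (BinaryAutoregression.step g t f) t k (η * v + (1 - η) * w) := by
  have key : ∀ y y' : ℤ → Fin 2, (∀ r, t - k ≤ r → r < t → y r = y' r) →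
      BinaryAutoregression.step g t f y - BinaryAutoregression.step g t f y'
        ≤ η * v + (1 - η) * w := by
    intro y y' hy
    have e1 := (abs_le.1 (hv _ _ (agree_update hy 1))).2
    have w11 := (abs_le.1 (hw (Function.update y t 1) (Function.update y' t 1)
      (by intro r; omega))).2
    have w10 := (abs_le.1 (hw (Function.update y t 1) (Function.update y' t 0)
      (by intro r; omega))).2
    have w01 := (abs_le.1 (hw (Function.update y t 0) (Function.update y' t 1)
      (by intro r; omega))).2
    have w00 := (abs_le.1 (hw (Function.update y t 0) (Function.update y' t 0)
      (by intro r; omega))).2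
    have a1 := h0 y
    have a2 := h0 y'
    have b1 := h1 y
    have b2 := h1 y'
    unfold BinaryAutoregression.step
    set A := f (Function.update y t 1)
    set B := f (Function.update y t 0)
    set A' := f (Function.update y' t 1)
    set B' := f (Function.update y' t 0)
    -- In the first case the coupling has masses `η`, `g y - η`, `g y' - g y`, `1 - g y'` on the
    -- draws `(1,1)`, `(1,1)`, `(0,1)`, `(0,0)`; the second is symmetric.
    rcases le_total (g y) (g y') with h | h
    · nlinarith [mul_le_mul_of_nonneg_left e1 hη,
        mul_le_mul_of_nonneg_left w11 (sub_nonneg.2 a1),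
        mul_le_mul_of_nonneg_left w01 (sub_nonneg.2 h),
        mul_le_mul_of_nonneg_left w00 (sub_nonneg.2 b2)]
    · nlinarith [mul_le_mul_of_nonneg_left e1 hη,
        mul_le_mul_of_nonneg_left w11 (sub_nonneg.2 a2),
        mul_le_mul_of_nonneg_left w10 (sub_nonneg.2 h),
        mul_le_mul_of_nonneg_left w00 (sub_nonneg.2 b1)]
  intro y y' hy
  rw [abs_le]
  constructor
  · linarith [key y' y fun r h1 h2 => (hy r h1 h2).symm]
  · exact key y y' hy

section

variable {g : ℤ → (ℤ → Fin 2) → ℝ} {b : ℕ → ℝ} {N : ℤ} {f : (ℤ → Fin 2) → ℝ}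

lemma OscLE.back_succ_zero (hg : IsTransition g b) {n : ℕ} {w : ℝ}
    (h : OscLE (back g N n f) (N - n) 0 w) :
    OscLE (back g N (n + 1) f) (N - (n + 1 : ℕ)) 0 w := by
  have h' : OscLE (back g N n f) (N - (n + 1) + 1) 0 w := by
    rwa [show N - (n + 1 : ℤ) + 1 = N - n by ring]
  have := OscLE.step_doeblin (t := N - (n + 1)) (k := 0) le_rfl
    (hg.nonneg (N - (n + 1))) (hg.le_one _) (h'.mono zero_le_one le_rfl) h'
  simpa [back] using this

lemma OscLE.back_add_zero (hg : IsTransition g b) {n : ℕ} {w : ℝ}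
    (h : OscLE (back g N n f) (N - n) 0 w) (j : ℕ) :
    OscLE (back g N (n + j) f) (N - (n + j : ℕ)) 0 w := by
  induction j with
  | zero => simpa using h
  | succ j ih => exact ih.back_succ_zero hg

/-- This is a union bound: pasts agreeing on `k` times keep agreeing for `j` more draws unless some
draw separates them, which for the `i`-th one has probability at most `b (k + i)` and costs at most
`w`. -/
lemma OscLE.back_add (hg : IsTransition g b) {n : ℕ} {v w : ℝ}
    (hw : OscLE (back g N n f) (N - n) 0 w) (j : ℕ) :
    ∀ k, OscLE (back g N n f) (N - n) (k + j) v →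
      OscLE (back g N (n + j) f) (N - (n + j : ℕ)) k
        (v + (∑ i ∈ Finset.range j, b (k + i)) * w) := by
  induction j with
  | zero => intro k h; simpa using h
  | succ j ih =>
    intro k h
    have h1 := ih (k + 1) (by rwa [add_right_comm, add_assoc])
    have h2 := hw.back_add_zero hg j
    rw [show (N : ℤ) - (n + j : ℕ) = N - ((n + j : ℕ) + 1) + 1 by ring] at h1 h2
    have := OscLE.step (hg.nonneg _) (hg.le_one _) (hg.osc _ k) h1 h2
    rw [Finset.sum_range_succ']
    refine OscLE.mono (f := back g N (n + j + 1) f) (k := k) ?_ le_rfl (le_of_eq ?_)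
      (v := v + (∑ i ∈ Finset.range j, b (k + 1 + i)) * w + b k * w)
    · simpa [back, add_assoc] using this
    · have : ∀ i, b (k + 1 + i) = b (k + (i + 1)) := fun i => by congr 1; ring
      simp only [this, add_zero]
      ring

/-- Where the value `1` always has probability at least `δ`, both copies show `1` at all `j` times
with mass `δ ^ j`. This creates agreement without requiring any beforehand. -/
lemma OscLE.back_add_doeblin (hg : IsTransition g b) {n : ℕ} {v w δ : ℝ} (hδ : 0 ≤ δ)
    (hw : OscLE (back g N n f) (N - n) 0 w) (j : ℕ)
    (hwin : ∀ r, N - (n + j : ℕ) ≤ r → r < N - n → ∀ y, δ ≤ g r y) :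
    ∀ k, OscLE (back g N n f) (N - n) (k + j) v →
      OscLE (back g N (n + j) f) (N - (n + j : ℕ)) k (δ ^ j * v + (1 - δ ^ j) * w) := by
  induction j with
  | zero => intro k h; simpa using h
  | succ j ih =>
    intro k h
    have h1 := ih (fun r hr => hwin r (by push_cast at hr ⊢; omega)) (k + 1)
      (by rwa [add_right_comm, add_assoc])
    have h2 := hw.back_add_zero hg j
    rw [show (N : ℤ) - (n + j : ℕ) = N - ((n + j : ℕ) + 1) + 1 by ring] at h1 h2
    have := OscLE.step_doeblin (k := k) hδ
      (hwin (N - ((n + j : ℕ) + 1)) (by push_cast; omega) (by push_cast; omega))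
      (hg.le_one _) h1 h2
    refine OscLE.mono (f := back g N (n + j + 1) f) (k := k) ?_ le_rfl (le_of_eq ?_)
      (v := δ * (δ ^ j * v + (1 - δ ^ j) * w) + (1 - δ) * w)
    · simpa [back, add_assoc] using this
    · ring

/-- Qualitative continuity after a fixed number of steps. It supplies the agreement length beyond
which `back_osc_tendsto` looks for its next window. -/
lemma back_small_osc (hg : IsTransition g b) (hb : Tendsto b atTop (𝓝 0)) {w : ℝ}
    (hw : OscLE f N 0 w) (hf : ∀ ε > 0, ∃ K, OscLE f N K ε) (n : ℕ) :
    ∀ ε > 0, ∃ K, OscLE (back g N n f) (N - n) K ε := by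
  induction n with
  | zero => simpa [back] using hf
  | succ n ih =>
    intro ε hε
    obtain ⟨K, hK⟩ := ih (ε / 2) (half_pos hε)
    have h2 : OscLE (back g N n f) (N - n) 0 w := by
      have := OscLE.back_add_zero (f := f) (N := N) (n := 0) hg (w := w)
        (by simpa [back] using hw) n
      simpa using this
    have hlim : Tendsto (fun k => b k * w) atTop (𝓝 0) := by simpa using hb.mul_const w
    obtain ⟨K', hK', hKK⟩ := ((hlim.eventually (ge_mem_nhds (half_pos hε))).and
      (eventually_ge_atTop K)).exists
    refine ⟨K', ?_⟩
    have h1 := hK.mono (hKK.trans (Nat.le_succ K')) le_rfl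
    rw [show (N : ℤ) - (n : ℤ) = N - (n + 1) + 1 by ring] at h1 h2
    have := OscLE.step (hg.nonneg _) (hg.le_one _) (hg.osc _ K') h1 h2
    refine OscLE.mono (f := back g N (n + 1) f) (k := K') ?_ le_rfl
      (show ε / 2 + b K' * w ≤ ε by linarith)
    simpa [back] using this

/-- Loss of memory: if, arbitrarily far in the past, there are windows of length `m` on which the
transition probabilities are bounded below, then the influence of the remote past vanishes. -/
theorem back_osc_tendsto (hg : IsTransition g b) (hb : Tendsto b atTop (𝓝 0)) {m : ℕ}
    (hm : ∀ j, ∑ i ∈ Finset.range j, b (m + i) ≤ 1 / 2)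
    (hwin : ∃ δ > 0, ∀ T : ℤ, ∃ s < T, ∀ r, s ≤ r → r < s + m → ∀ y, δ ≤ g r y) {w : ℝ}
    (hw : OscLE f N 0 w) (hf : ∀ ε > 0, ∃ K, OscLE f N K ε) :
    ∀ ε > 0, ∃ n₀, ∀ n ≥ n₀, OscLE (back g N n f) (N - n) 0 ε := by
  obtain ⟨δ₁, hδ₁, hwin⟩ := hwin
  obtain ⟨δ, hδ, hδ1, hδδ⟩ : ∃ δ : ℝ, 0 < δ ∧ δ ≤ 1 ∧ δ ≤ δ₁ :=
    ⟨min δ₁ 1, lt_min hδ₁ one_pos, min_le_right _ _, min_le_left _ _⟩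
  -- Going back `j` steps reaches the right end `s + m` of a window lying more than `K` times back.
  -- Agreement on the whole window leaves an oscillation of at most `v / 4 + v / 2`; crossing it
  -- then leaves `δ ^ m * (3 / 4 * v) + (1 - δ ^ m) * v`.
  have contract : ∀ v > 0, (∃ n, OscLE (back g N n f) (N - n) 0 v) →
      ∃ n, OscLE (back g N n f) (N - n) 0 (v * (1 - δ ^ m / 4)) := by
    rintro v hv ⟨n, hn⟩
    obtain ⟨K, hK⟩ := back_small_osc hg hb hw hf n (v / 4) (by linarith)
    obtain ⟨s, hs, hsw⟩ := hwin (N - n - K - m)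
    obtain ⟨j, hj⟩ := Int.eq_ofNat_of_zero_le (show 0 ≤ N - n - m - s by omega)
    have h1 := hn.back_add hg j m (hK.mono (by omega) le_rfl)
    have h1' : OscLE (back g N (n + j) f) (N - (n + j : ℕ)) (0 + m) (3 / 4 * v) := by
      refine h1.mono (by simp) ?_
      nlinarith [hm j]
    have h2 := OscLE.back_add_doeblin hg hδ.le (hn.back_add_zero hg j) m ?_ 0 h1'
    · exact ⟨_, h2.mono le_rfl (by ring_nf; rfl)⟩
    · intro r h1 h2 y
      exact hδδ.trans (hsw r (by push_cast at h1; omega) (by push_cast at h2; omega) y)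
  have hpow : 0 < δ ^ m := pow_pos hδ m
  have hpow1 : δ ^ m ≤ 1 := pow_le_one₀ hδ.le hδ1
  -- The bound `w` may vanish, whereas `contract` needs a positive one.
  have hw1 : 0 < w + 1 := by linarith [hw.nonneg]
  have iter : ∀ i : ℕ, ∃ n, OscLE (back g N n f) (N - n) 0 ((w + 1) * (1 - δ ^ m / 4) ^ i) := by
    intro i
    induction i with
    | zero => exact ⟨0, by simpa [back] using hw.mono le_rfl (by linarith)⟩
    | succ i ih =>
      obtain ⟨n, hn⟩ := contract _ (mul_pos hw1 (pow_pos (by linarith) i)) ih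
      exact ⟨n, by rwa [pow_succ, ← mul_assoc]⟩
  intro ε hε
  have hlim : Tendsto (fun i : ℕ => (w + 1) * (1 - δ ^ m / 4) ^ i) atTop (𝓝 0) := by
    simpa using (tendsto_pow_atTop_nhds_zero_of_lt_one (r := 1 - δ ^ m / 4)
      (by linarith) (by linarith)).const_mul (w + 1)
  obtain ⟨i, hi⟩ := (hlim.eventually (ge_mem_nhds hε)).exists
  obtain ⟨n, hn⟩ := iter i
  refine ⟨n, fun n' hn' => ?_⟩
  obtain ⟨j, rfl⟩ := Nat.exists_eq_add_of_le hn'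
  exact (hn.back_add_zero hg j).mono le_rfl hi

end

/-! ### Existence of the chain in a fixed environment. -/

/-- The sequence with all values from time `t` on replaced by `0`. -/
def trunc (t : ℤ) (y : ℤ → Fin 2) : ℤ → Fin 2 := fun r => if r < t then y r else 0

lemma trunc_congr {t : ℤ} {y y' : ℤ → Fin 2} (h : ∀ r ∈ Set.Iio t, y r = y' r) :
    trunc t y = trunc t y' := by
  funext r
  by_cases hr : r < t
  · simp [trunc, hr, h r hr]
  · simp [trunc, hr]

lemma trunc_eq (t : ℤ) (y : ℤ → Fin 2) : ∀ r ∈ Set.Iio t, trunc t y r = y r := fun _ hr =>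
  if_pos hr

lemma trunc_update (t : ℤ) (y : ℤ → Fin 2) (i : Fin 2) :
    trunc t (Function.update y t i) = trunc t y :=
  trunc_congr fun _ hr => Function.update_of_ne (ne_of_lt hr) _ _

lemma continuous_trunc (t : ℤ) : Continuous (trunc t) := by
  refine continuous_pi fun r => ?_
  by_cases hr : r < t
  · simpa [trunc, hr] using continuous_apply r
  · simp [trunc, hr, continuous_const]

lemma measurable_trunc (t : ℤ) : Measurable (trunc t) := by
  refine measurable_pi_lambda _ fun r => ?_
  by_cases hr : r < t
  · simpa [trunc, hr] using measurable_pi_apply r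
  · simp [trunc, hr]

lemma _root_.DependsOn.apply_trunc {β : Type*} {t : ℤ} {f : (ℤ → Fin 2) → β}
    (hf : DependsOn f (Set.Iio t)) (y : ℤ → Fin 2) : f (trunc t y) = f y :=
  hf (trunc_eq t y)

lemma continuous_of_osc {f : (ℤ → Fin 2) → ℝ} {t : ℤ} (hf : ∀ ε > 0, ∃ K, OscLE f t K ε) :
    Continuous f := by
  refine continuous_iff_continuousAt.2 fun y => Metric.continuousAt_iff'.2 fun ε hε => ?_
  obtain ⟨K, hK⟩ := hf (ε / 2) (half_pos hε)
  have : ∀ᶠ y' in 𝓝 y, ∀ r ∈ Finset.Ico (t - K) t, y' r = y r := by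
    rw [Filter.eventually_all_finset]
    intro r _
    have := (continuous_apply (A := fun _ : ℤ => Fin 2) r).tendsto y
    rw [nhds_discrete (Fin 2), tendsto_pure] at this
    exact this
  filter_upwards [this] with y' hy'
  rw [Real.dist_eq]
  refine lt_of_le_of_lt (hK y' y fun r h1 h2 => hy' r (Finset.mem_Ico.2 ⟨h1, h2⟩)) (by linarith)

lemma dependsOn_of_osc {f : (ℤ → Fin 2) → ℝ} {t : ℤ} (hf : ∀ ε > 0, ∃ K, OscLE f t K ε) :
    DependsOn f (Set.Iio t) := by
  intro y y' h
  refine sub_eq_zero.1 (abs_eq_zero.1 (le_antisymm ?_ (abs_nonneg _)))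
  refine le_of_forall_pos_le_add fun ε hε => ?_
  obtain ⟨K, hK⟩ := hf ε hε
  simpa using hK y y' fun r _ h2 => h r h2

lemma DependsOn.step {g f : (ℤ → Fin 2) → ℝ} {t : ℤ} (hg : DependsOn g (Set.Iio t))
    (hf : DependsOn f (Set.Iio (t + 1))) : DependsOn (step g t f) (Set.Iio t) := by
  intro y y' h
  have : ∀ i, f (Function.update y t i) = f (Function.update y' t i) := fun i => hf fun r hr => by
    by_cases hrt : r = t
    · simp [hrt]
    · simp only [Function.update_of_ne hrt]
      exact h r (by simp only [Set.mem_Iio] at hr ⊢; omega)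
  simp only [BinaryAutoregression.step, hg h, this]

lemma step_of_dependsOn (g : (ℤ → Fin 2) → ℝ) {f : (ℤ → Fin 2) → ℝ} {t : ℤ}
    (hf : DependsOn f (Set.Iio t)) : step g t f = f := by
  funext y
  have : ∀ i, f (Function.update y t i) = f y := fun i => hf fun r hr =>
    Function.update_of_ne (ne_of_lt hr) _ _
  simp only [step, this]
  ring

lemma continuous_step {g f : (ℤ → Fin 2) → ℝ} (hg : Continuous g) (hf : Continuous f) (t : ℤ) :
    Continuous (step g t f) := by
  have h : ∀ i : Fin 2, Continuous fun y : ℤ → Fin 2 => f (Function.update y t i) := fun i =>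
    hf.comp (continuous_id.update t continuous_const)
  exact (hg.mul (h 1)).add ((continuous_const.sub hg).mul (h 0))

lemma DependsOn.mono_Iio {f : (ℤ → Fin 2) → ℝ} {s t : ℤ} (hf : DependsOn f (Set.Iio s))
    (h : s ≤ t) : DependsOn f (Set.Iio t) :=
  fun _ _ hy => hf fun r hr => hy r (lt_of_lt_of_le hr h)

section

variable {g : ℤ → (ℤ → Fin 2) → ℝ}

lemma continuous_back (hg : ∀ t, Continuous (g t)) (N : ℤ) {f : (ℤ → Fin 2) → ℝ}
    (hf : Continuous f) (n : ℕ) : Continuous (back g N n f) := by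
  induction n with
  | zero => exact hf
  | succ n ih => exact continuous_step (hg _) ih _

lemma dependsOn_back (hg : ∀ t, DependsOn (g t) (Set.Iio t)) {N : ℤ} {f : (ℤ → Fin 2) → ℝ}
    (hf : DependsOn f (Set.Iio N)) (n : ℕ) : DependsOn (back g N n f) (Set.Iio (N - n)) := by
  induction n with
  | zero => simpa [back] using hf
  | succ n ih =>
    rw [Nat.cast_succ]
    refine DependsOn.step (hg _) ?_
    rwa [show N - (n + 1 : ℤ) + 1 = N - n by ring]

lemma back_of_dependsOn {N : ℤ} {n : ℕ} {f : (ℤ → Fin 2) → ℝ}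
    (hf : DependsOn f (Set.Iio (N - n))) : back g N n f = f := by
  induction n with
  | zero => rfl
  | succ n ih =>
    rw [back, ih (DependsOn.mono_Iio hf (by push_cast; omega)), step_of_dependsOn]
    simpa using hf

lemma back_add_congr {N : ℤ} {n : ℕ} {f f' : (ℤ → Fin 2) → ℝ} (h : back g N n f = back g N n f')
    (i : ℕ) : back g N (n + i) f = back g N (n + i) f' := by
  induction i with
  | zero => exact h
  | succ i ih => rw [← add_assoc, back, back, ih]

/-- Averages at times after `t` fix both functions, and the average at `t` sends `f` to `step (g t)
t f` while fixing the latter. From there on the two computations coincide. -/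
lemma back_step (hg : ∀ t, DependsOn (g t) (Set.Iio t)) {N t : ℤ} {n : ℕ} (h1 : t < N)
    (h2 : N - n ≤ t) {f : (ℤ → Fin 2) → ℝ} (hf : DependsOn f (Set.Iio (t + 1))) :
    back g N n f = back g N n (step (g t) t f) := by
  obtain ⟨j, hj⟩ := Int.eq_ofNat_of_zero_le (show 0 ≤ N - (t + 1) by omega)
  obtain ⟨i, rfl⟩ := Nat.exists_eq_add_of_le (show j + 1 ≤ n by omega)
  have e1 : N - (j : ℤ) = t + 1 := by omega
  have e2 : N - ((j : ℤ) + 1) = t := by omega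
  refine back_add_congr ?_ i
  have hf' := DependsOn.step (hg t) hf
  rw [back_of_dependsOn (n := j + 1) (f := step (g t) t f) (by push_cast; rwa [e2]), back,
    back_of_dependsOn (n := j) (by rwa [e1]), e2]

/-- The measure is a finite mixture of Dirac masses; in this form the averages are open to a
compactness argument. -/
lemma exists_measure_integral_eq_back (h0 : ∀ t y, 0 ≤ g t y) (h1 : ∀ t y, g t y ≤ 1) (N : ℤ)
    (n : ℕ) (y : ℤ → Fin 2) : ∃ κ : ProbabilityMeasure (ℤ → Fin 2),
      ∀ f : (ℤ → Fin 2) → ℝ, Continuous f → ∫ z, f z ∂(κ : Measure _) = back g N n f y := by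
  induction n generalizing y with
  | zero => exact ⟨⟨Measure.dirac y, inferInstance⟩, fun f _ => by simp [back]⟩
  | succ n ih =>
    set t := N - ((n : ℤ) + 1)
    obtain ⟨κ1, hκ1⟩ := ih (Function.update y t 1)
    obtain ⟨κ0, hκ0⟩ := ih (Function.update y t 0)
    have hp : IsProbabilityMeasure (ENNReal.ofReal (g t y) • (κ1 : Measure (ℤ → Fin 2))
        + ENNReal.ofReal (1 - g t y) • (κ0 : Measure (ℤ → Fin 2))) := by
      constructor
      simp only [Measure.add_apply, Measure.smul_apply, measure_univ, smul_eq_mul, mul_one]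
      rw [← ENNReal.ofReal_add (h0 t y) (by linarith [h1 t y])]
      simp
    refine ⟨⟨_, hp⟩, fun f hf => ?_⟩
    have hint : ∀ κ : ProbabilityMeasure (ℤ → Fin 2), Integrable f (κ : Measure _) := fun κ =>
      hf.integrable_of_hasCompactSupport (HasCompactSupport.of_compactSpace f)
    simp only [ProbabilityMeasure.coe_mk]
    rw [integral_add_measure ((hint κ1).smul_measure ENNReal.ofReal_ne_top)
      ((hint κ0).smul_measure ENNReal.ofReal_ne_top), integral_smul_measure, integral_smul_measure,
      hκ1 f hf, hκ0 f hf, ENNReal.toReal_ofReal (h0 t y),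
      ENNReal.toReal_ofReal (by linarith [h1 t y])]
    rfl

/-- Existence of a chain with given continuous transition probabilities. -/
theorem exists_compatible_measure (h0 : ∀ t y, 0 ≤ g t y) (h1 : ∀ t y, g t y ≤ 1)
    (hc : ∀ t, Continuous (g t)) (hg : ∀ t, DependsOn (g t) (Set.Iio t)) :
    ∃ κ : Measure (ℤ → Fin 2), IsProbabilityMeasure κ ∧
      ∀ t, ∀ f : (ℤ → Fin 2) → ℝ, Continuous f → DependsOn f (Set.Iio (t + 1)) →
        ∫ y, f y ∂κ = ∫ y, step (g t) t f y ∂κ := by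
  -- The chain starts from the zero past at time `-n` and runs through time `n - 1`, so `κ n` has
  -- the right transition at every `t` with `|t| < n`. Each such identity survives in an ultrafilter
  -- limit, since `step` preserves continuity.
  choose κ hκ using fun n : ℕ => exists_measure_integral_eq_back h0 h1 n (2 * n) 0
  set U : Filter ℕ := (hyperfilter ℕ : Filter ℕ)
  obtain ⟨κ', -, hκ'⟩ := isCompact_univ.ultrafilter_le_nhds
    ((hyperfilter ℕ).map κ) (by simp)
  have hlim : Tendsto κ U (𝓝 κ') := hκ'
  rw [ProbabilityMeasure.tendsto_iff_forall_integral_tendsto] at hlim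
  have hlim' : ∀ f : (ℤ → Fin 2) → ℝ, Continuous f →
      Tendsto (fun n : ℕ => back g n (2 * n) f 0) U (𝓝 (∫ y, f y ∂(κ' : Measure _))) := by
    intro f hf
    have := hlim (BoundedContinuousFunction.mkOfCompact ⟨f, hf⟩)
    simp only [BoundedContinuousFunction.mkOfCompact_apply, ContinuousMap.coe_mk] at this
    simpa only [hκ _ f hf] using this
  refine ⟨κ', inferInstance, fun t f hf hft => ?_⟩
  have h2 := hlim' _ (continuous_step (hc t) hf t)
  refine tendsto_nhds_unique ((hlim' f hf).congr' ?_) h2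
  have : ∀ᶠ n : ℕ in atTop, back g n (2 * n) f 0 = back g n (2 * n) (step (g t) t f) 0 := by
    filter_upwards [eventually_gt_atTop t.natAbs] with n hn
    rw [back_step hg (by omega) (by push_cast; omega) hft]
  exact this.filter_mono (by rw [← Nat.cofinite_eq_atTop]; exact hyperfilter_le_cofinite)

lemma integral_eq_integral_back {κ : Measure (ℤ → Fin 2)} (hc : ∀ t, Continuous (g t))
    (hg : ∀ t, DependsOn (g t) (Set.Iio t))
    (hκ : ∀ t, ∀ f : (ℤ → Fin 2) → ℝ, Continuous f → DependsOn f (Set.Iio (t + 1)) →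
        ∫ y, f y ∂κ = ∫ y, step (g t) t f y ∂κ)
    {N : ℤ} {f : (ℤ → Fin 2) → ℝ} (hf : Continuous f) (hfN : DependsOn f (Set.Iio N)) (n : ℕ) :
    ∫ y, f y ∂κ = ∫ y, back g N n f y ∂κ := by
  induction n with
  | zero => rfl
  | succ n ih =>
    rw [ih]
    refine hκ _ _ (continuous_back hc N hf n) ?_
    have := dependsOn_back hg hfN n
    rwa [show N - (n + 1 : ℤ) + 1 = N - n by ring]

/-- Continuous test functions suffice: the laws of the truncated sequence weighted by `y t` and by
`g t y` are finite measures with the same integrals of bounded continuous functions, hence equal. -/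
lemma integral_trunc_eq {κ : Measure (ℤ → Fin 2)} [IsProbabilityMeasure κ]
    (h0 : ∀ t y, 0 ≤ g t y) (h1 : ∀ t y, g t y ≤ 1) (hc : ∀ t, Continuous (g t))
    (hκ : ∀ t, ∀ f : (ℤ → Fin 2) → ℝ, Continuous f → DependsOn f (Set.Iio (t + 1)) →
        ∫ y, f y ∂κ = ∫ y, step (g t) t f y ∂κ) (t : ℤ) {h : (ℤ → Fin 2) → ℝ}
    (hh : Measurable h) :
    ∫ y, h (trunc t y) * ((y t : ℕ) : ℝ) ∂κ = ∫ y, h (trunc t y) * g t y ∂κ := by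
  have hvm : Measurable fun y : ℤ → Fin 2 => ENNReal.ofReal ((y t : ℕ) : ℝ) :=
    (Measurable.of_discrete (f := fun i : Fin 2 => ENNReal.ofReal ((i : ℕ) : ℝ))).comp
      (measurable_pi_apply t)
  have hgm : Measurable fun y : ℤ → Fin 2 => ENNReal.ofReal (g t y) :=
    (hc t).measurable.ennreal_ofReal
  have hle : ∀ {p : ℝ}, p ≤ 1 → ENNReal.ofReal p ≤ 1 := fun hp => by simpa using hp
  have hval : ∀ i : Fin 2, ((i : ℕ) : ℝ) ≤ 1 := fun i => by
    exact_mod_cast Nat.lt_succ_iff.1 i.2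
  have conv : ∀ {p : (ℤ → Fin 2) → ℝ}, (∀ y, 0 ≤ p y) →
      Measurable (fun y => ENNReal.ofReal (p y)) → ∀ {h : (ℤ → Fin 2) → ℝ}, Measurable h →
      ∫ y, h y ∂((κ.withDensity fun y => ENNReal.ofReal (p y)).map (trunc t))
        = ∫ y, h (trunc t y) * p y ∂κ := by
    intro p hp hpm h hh
    rw [integral_map (measurable_trunc t).aemeasurable hh.aestronglyMeasurable,
      integral_withDensity_eq_integral_toReal_smul hpm (by simp)]
    refine integral_congr_ae (Eventually.of_forall fun y => ?_)
    simp only [smul_eq_mul, ENNReal.toReal_ofReal (hp y)]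
    ring
  have hfin : ∀ {p : (ℤ → Fin 2) → ℝ}, (∀ y, p y ≤ 1) →
      IsFiniteMeasure (κ.withDensity fun y => ENNReal.ofReal (p y)) := by
    intro p hp
    refine isFiniteMeasure_withDensity (ne_of_lt ?_)
    calc ∫⁻ y, ENNReal.ofReal (p y) ∂κ ≤ ∫⁻ _, 1 ∂κ := lintegral_mono fun y => hle (hp y)
      _ < ⊤ := by simp
  have := hfin (h1 t)
  have := hfin fun y : ℤ → Fin 2 => hval (y t)
  have heq : (κ.withDensity fun y => ENNReal.ofReal ((y t : ℕ) : ℝ)).map (trunc t)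
      = (κ.withDensity fun y => ENNReal.ofReal (g t y)).map (trunc t) := by
    refine ext_of_forall_integral_eq_of_IsFiniteMeasure fun f => ?_
    rw [conv (fun y => by positivity) hvm f.continuous.measurable,
      conv (h0 t) hgm f.continuous.measurable, hκ t]
    · refine integral_congr_ae (Eventually.of_forall fun y => ?_)
      simp [step, trunc_update, mul_comm]
    · exact (f.continuous.comp (continuous_trunc t)).mul
        ((continuous_of_discreteTopology (f := fun i : Fin 2 => ((i : ℕ) : ℝ))).comp
          (continuous_apply t))
    · intro y y' hy
      have e := trunc_congr (t := t) (y := y) (y' := y')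
        fun r hr => hy r (by simp only [Set.mem_Iio] at hr ⊢; omega)
      simp only [e, hy t (by simp)]
  rw [← conv (fun y => by positivity) hvm hh, ← conv (h0 t) hgm hh, heq]

end

/-- The indicator of a cylinder depends only on a finite window. -/
lemma cylinder_indicator_osc {C : Set (ℤ → Fin 2)} (hC : C ∈ measurableCylinders fun _ => Fin 2) :
    ∃ N : ℤ, OscLE (C.indicator 1) N 0 1 ∧ ∃ K, OscLE (C.indicator 1) N K 0 := by
  obtain ⟨s, S, -, rfl⟩ := (mem_measurableCylinders C).1 hC
  have hM : ∀ r ∈ s, r.natAbs ≤ s.sup Int.natAbs := fun r hr => Finset.le_sup hr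
  set M := s.sup Int.natAbs
  refine ⟨M + 1, fun y y' _ => ?_, 2 * M + 1, fun y y' hy => ?_⟩
  · by_cases h : y ∈ cylinder s S <;> by_cases h' : y' ∈ cylinder s S <;> simp [h, h']
  · have : y ∈ cylinder s S ↔ y' ∈ cylinder s S := by
      rw [mem_cylinder, mem_cylinder]
      have : s.restrict y = s.restrict y' := by
        funext ⟨r, hr⟩
        have := hM r hr
        exact hy r (by push_cast; omega) (by omega)
      rw [this]
    by_cases h : y ∈ cylinder s S
    · simp [h, this.1 h]
    · rw [Set.indicator_of_notMem h, Set.indicator_of_notMem (mt this.2 h)]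
      simp

/-! ### The time shift and recurrence. -/

section Shift

lemma shift_iterate {S : Type*} (n : ℕ) (x : ℤ → S) (t : ℤ) : (shift^[n] x) t = x (t + n) := by
  induction n generalizing x with
  | zero => simp
  | succ n ih =>
    rw [Function.iterate_succ_apply, ih, shift]
    congr 1
    push_cast
    ring

variable {S : Type*} [MeasurableSpace S]

/-- The time shift as a measurable equivalence. -/
def shiftEquiv (S : Type*) [MeasurableSpace S] : (ℤ → S) ≃ᵐ (ℤ → S) where
  toFun := shift
  invFun x := fun t => x (t - 1)
  left_inv x := by funext t; simp [shift]
  right_inv x := by funext t; simp [shift]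
  measurable_toFun := measurable_pi_lambda _ fun _ => measurable_pi_apply _
  measurable_invFun := measurable_pi_lambda _ fun _ => measurable_pi_apply _

lemma measurable_shift : Measurable (shift : (ℤ → S) → ℤ → S) := (shiftEquiv S).measurable

lemma shiftEquiv_symm_apply (x : ℤ → S) (t : ℤ) : (shiftEquiv S).symm x t = x (t - 1) := rfl

lemma shiftEquiv_symm_iterate (n : ℕ) (x : ℤ → S) (t : ℤ) :
    ((shiftEquiv S).symm^[n] x) t = x (t - n) := by
  induction n generalizing x with
  | zero => simp
  | succ n ih =>
    rw [Function.iterate_succ_apply, ih, shiftEquiv_symm_apply]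
    congr 1
    push_cast
    ring

variable {π : Measure (ℤ → S)}

lemma measure_coordinate_eq (hπ : MeasurePreserving shift π π) {B : Set S} (hB : MeasurableSet B)
    (t : ℤ) : π {x | x t ∈ B} = π {x | x 0 ∈ B} := by
  have h : ∀ t, π {x | x (t + 1) ∈ B} = π {x | x t ∈ B} := fun t =>
    hπ.measure_preimage ((measurable_pi_apply t) hB).nullMeasurableSet
  induction t using Int.induction_on with
  | zero => rfl
  | succ i ih => rw [h, ih]
  | pred i ih => rw [← ih, ← h (-(i : ℤ) - 1), sub_add_cancel]

/-- Recurrence of windows for a stationary sequence of positive variables. -/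
lemma ae_frequently_window [IsProbabilityMeasure π] (hπ : MeasurePreserving shift π π)
    {η : ℤ → (ℤ → S) → ℝ} (hm : ∀ t, Measurable (η t)) (hshift : ∀ t x, η t (shift x) = η (t + 1) x)
    (hpos : ∀ t x, 0 < η t x) (m : ℕ) :
    ∀ᵐ x ∂π, ∃ δ > 0, ∀ T : ℤ, ∃ s < T, ∀ r, s ≤ r → r < s + m → δ ≤ η r x := by
  have hsymm : MeasurePreserving (shiftEquiv S).symm π π :=
    MeasurePreserving.symm (shiftEquiv S) hπ
  have hη : ∀ (n : ℕ) r x, η r ((shiftEquiv S).symm^[n] x) = η (r - n) x := by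
    intro n
    induction n with
    | zero => simp
    | succ n ih =>
      intro r x
      have h1 : ∀ r x, η r ((shiftEquiv S).symm x) = η (r - 1) x := fun r x => by
        have := hshift (r - 1) ((shiftEquiv S).symm x)
        rw [sub_add_cancel] at this
        rw [← this]
        exact congrArg _ ((shiftEquiv S).apply_symm_apply x)
      rw [Function.iterate_succ_apply, ih, h1]
      congr 1
      push_cast
      ring
  -- By positivity of `η` these sets exhaust the space. Recurrence for the inverse shift brings a
  -- path back to the same set, hence to the same lower bound, at arbitrarily remote past times.
  let s : ℕ → Set (ℤ → S) := fun k => ⋂ r ∈ Finset.range m, {x | 1 / ((k : ℝ) + 1) ≤ η (r : ℕ) x}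
  have hs : ∀ k, MeasurableSet (s k) := fun k =>
    Finset.measurableSet_biInter _ fun r _ => measurableSet_le measurable_const (hm _)
  have hrec : ∀ᵐ x ∂π, ∀ k, x ∈ s k → ∃ᶠ n in atTop, (shiftEquiv S).symm^[n] x ∈ s k :=
    ae_all_iff.2 fun k =>
      hsymm.conservative.ae_mem_imp_frequently_image_mem (hs k).nullMeasurableSet
  filter_upwards [hrec] with x hx
  obtain ⟨k, hk⟩ : ∃ k, x ∈ s k := by
    have : ∀ᶠ k : ℕ in atTop, ∀ r ∈ Finset.range m, 1 / ((k : ℝ) + 1) ≤ η (r : ℕ) x := by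
      rw [Filter.eventually_all_finset]
      intro r _
      exact tendsto_one_div_add_atTop_nhds_zero_nat.eventually (ge_mem_nhds (hpos _ x))
    obtain ⟨k, hk⟩ := this.exists
    exact ⟨k, by simpa [s] using hk⟩
  refine ⟨1 / ((k : ℝ) + 1), by positivity, fun T => ?_⟩
  obtain ⟨n, hn, hn'⟩ := (frequently_atTop.1 (hx k hk)) (T.natAbs + 1)
  refine ⟨-(n : ℤ), by omega, fun r h1 h2 => ?_⟩
  obtain ⟨i, hi⟩ := Int.eq_ofNat_of_zero_le (show 0 ≤ r + n by omega)
  have him : i < m := by omega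
  have := Set.mem_iInter₂.1 hn' i (Finset.mem_range.2 him)
  simp only [Set.mem_ofPred_eq, hη] at this
  rwa [show r = (i : ℤ) - n by omega]

end Shift

/-! ### The latent process as a causal filter. -/

section Latent

variable {d : ℕ} (q p : ℕ) (β α : ℕ → ℝ) (γ : EuclideanSpace ℝ (Fin d))

/-- The contribution of the responses and covariates to the latent process. -/
noncomputable def input (t : ℤ) (y : ℤ → Fin 2) (x : ℤ → EuclideanSpace ℝ (Fin d)) : ℝ :=
  ∑ k ∈ Finset.Icc 1 p, α k * ((y (t - (k : ℤ)) : ℕ) : ℝ) + inner ℝ γ (x t)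

/-- The latent process as a causal function of the responses and the covariates. -/
noncomputable def latent (t : ℤ) (y : ℤ → Fin 2) (x : ℤ → EuclideanSpace ℝ (Fin d)) : ℝ :=
  ∑' n : ℕ, impulse q β n * input p α γ (t - n) y x

/-- Covariate paths growing subexponentially into the past, relative to the rate `ρ`. -/
def Tame (ρ : ℝ) (x : ℤ → EuclideanSpace ℝ (Fin d)) : Prop :=
  ∀ t : ℤ, Summable fun n : ℕ => ρ ^ n * ‖x (t - n)‖

variable {q p β α γ}

lemma latent_shift (t : ℤ) (y : ℤ → Fin 2) (x : ℤ → EuclideanSpace ℝ (Fin d)) :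
    latent q p β α γ t (shift y) (shift x) = latent q p β α γ (t + 1) y x := by
  refine tsum_congr fun n => ?_
  have e : ∀ k : ℤ, t - n - k + 1 = t + 1 - n - k := fun k => by ring
  have e' : t - n + 1 = t + 1 - (n : ℤ) := by ring
  simp only [input, shift, e, e']

lemma measurable_latent {Ω : Type*} [MeasurableSpace Ω] {t : ℤ} {Y : ℤ → Ω → Fin 2}
    {X : ℤ → Ω → EuclideanSpace ℝ (Fin d)} (hY : ∀ s < t, Measurable (Y s))
    (hX : ∀ s, Measurable (X s)) :
    Measurable fun ω => latent q p β α γ t (fun s => Y s ω) (fun s => X s ω) := by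
  unfold latent input
  refine Measurable.tsum fun n => Measurable.const_mul ?_ _
  refine Measurable.add (Finset.measurable_sum _ fun k hk => ?_) ?_
  · refine Measurable.const_mul ?_ _
    have hlt : t - (n : ℤ) - k < t := by
      have := (Finset.mem_Icc.1 hk).1
      omega
    exact (Measurable.of_discrete (f := fun i : Fin 2 => ((i : ℕ) : ℝ))).comp (hY _ hlt)
  · exact Measurable.const_inner (hX _)

lemma abs_input_le (t : ℤ) (y : ℤ → Fin 2) (x : ℤ → EuclideanSpace ℝ (Fin d)) :
    |input p α γ t y x| ≤ ∑ k ∈ Finset.Icc 1 p, |α k| + ‖γ‖ * ‖x t‖ := by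
  refine (abs_add_le _ _).trans (add_le_add ?_ (abs_real_inner_le_norm _ _))
  refine (Finset.abs_sum_le_sum_abs _ _).trans (Finset.sum_le_sum fun k _ => ?_)
  rw [abs_mul]
  refine mul_le_of_le_one_right (abs_nonneg _) ?_
  rw [abs_of_nonneg (by positivity)]
  exact_mod_cast Nat.lt_succ_iff.1 (y (t - (k : ℤ))).2

variable {C ρ : ℝ}

lemma Tame.summable_input (hρ0 : 0 < ρ) (hρ1 : ρ < 1) {x : ℤ → EuclideanSpace ℝ (Fin d)}
    (hx : Tame ρ x) (y : ℤ → Fin 2) (t : ℤ) :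
    Summable fun n : ℕ => ρ ^ n * |input p α γ (t - n) y x| := by
  refine Summable.of_nonneg_of_le (fun n => by positivity) (fun n => ?_)
    (((summable_geometric_of_lt_one hρ0.le hρ1).mul_right (∑ k ∈ Finset.Icc 1 p, |α k|)).add
      ((hx t).mul_left ‖γ‖))
  calc ρ ^ n * |input p α γ (t - n) y x|
      ≤ ρ ^ n * (∑ k ∈ Finset.Icc 1 p, |α k| + ‖γ‖ * ‖x (t - n)‖) :=
        mul_le_mul_of_nonneg_left (abs_input_le _ _ _) (by positivity)
    _ = _ := by ring

lemma Tame.summable_latent (hM : ∀ n i j, |(companion q β ^ n) i j| ≤ C * ρ ^ n)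
    (hρ0 : 0 < ρ) (hρ1 : ρ < 1) {x : ℤ → EuclideanSpace ℝ (Fin d)}
    (hx : Tame ρ x) (y : ℤ → Fin 2) (t : ℤ) :
    Summable fun n : ℕ => impulse q β n * input p α γ (t - n) y x :=
  Summable.of_norm_bounded ((hx.summable_input (p := p) (α := α) (γ := γ) hρ0 hρ1 y t).mul_left C)
    fun n => by
      rw [Real.norm_eq_abs, abs_mul, ← mul_assoc]
      exact mul_le_mul_of_nonneg_right (hM n 0 0) (abs_nonneg _)

lemma Tame.latent_recursion (hM : ∀ n i j, |(companion q β ^ n) i j| ≤ C * ρ ^ n)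
    (hρ0 : 0 < ρ) (hρ1 : ρ < 1) {x : ℤ → EuclideanSpace ℝ (Fin d)}
    (hx : Tame ρ x) (y : ℤ → Fin 2) (t : ℤ) :
    latent q p β α γ t y x = ∑ j ∈ Finset.Icc 1 q, β j * latent q p β α γ (t - (j : ℤ)) y x
      + ∑ k ∈ Finset.Icc 1 p, α k * ((y (t - (k : ℤ)) : ℕ) : ℝ) + inner ℝ γ (x t) := by
  have := impulse_recursion hM (u := fun t => input p α γ t y x)
    (hx.summable_input hρ0 hρ1 y) t
  rw [add_assoc]
  exact this

/-- The constant in the modulus of continuity of the latent process. -/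
noncomputable def latentConst (p : ℕ) (α : ℕ → ℝ) (C ρ : ℝ) : ℝ :=
  C * (∑ k ∈ Finset.Icc 1 p, |α k|) / √ρ ^ p * (1 - √ρ)⁻¹

/-- The input at time `t - n` reads responses no further back than `t - n - p`, so only the `n` with
`n + p > k` contribute, each at most `C * ρ ^ n * ∑ |α k|`. One factor `√ρ ^ n` yields the decay in
`k`, the other sums over `n`. The constant is free of `x`. -/
lemma Tame.osc_latent (hM : ∀ n i j, |(companion q β ^ n) i j| ≤ C * ρ ^ n)
    (hC : 0 ≤ C) (hρ0 : 0 < ρ) (hρ1 : ρ < 1) {x : ℤ → EuclideanSpace ℝ (Fin d)}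
    (hx : Tame ρ x) (t : ℤ) (k : ℕ) :
    OscLE (fun y => latent q p β α γ t y x) t k (latentConst p α C ρ * √ρ ^ k) := by
  intro y y' hy
  have hr0 : 0 < √ρ := Real.sqrt_pos.2 hρ0
  have hr1 : √ρ < 1 := by rw [Real.sqrt_lt' one_pos]; simpa using hρ1
  set r := √ρ with hr
  have hrr : ∀ n : ℕ, ρ ^ n = r ^ n * r ^ n := fun n => by
    rw [← mul_pow, hr, Real.mul_self_sqrt hρ0.le]
  set A := ∑ k ∈ Finset.Icc 1 p, |α k| with hA
  have hA0 : 0 ≤ A := Finset.sum_nonneg fun _ _ => abs_nonneg _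
  have hterm : ∀ n : ℕ, ‖impulse q β n * input p α γ (t - n) y x
      - impulse q β n * input p α γ (t - n) y' x‖ ≤ C * A / r ^ p * r ^ k * r ^ n := by
    intro n
    rw [← mul_sub, Real.norm_eq_abs, abs_mul]
    have hdiff : input p α γ (t - n) y x - input p α γ (t - n) y' x
        = ∑ j ∈ Finset.Icc 1 p,
          α j * (((y (t - n - (j : ℤ)) : ℕ) : ℝ) - ((y' (t - n - (j : ℤ)) : ℕ) : ℝ)) := by
      simp only [input, mul_sub, Finset.sum_sub_distrib]
      ring
    by_cases hnk : n + p ≤ k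
    · have : input p α γ (t - n) y x - input p α γ (t - n) y' x = 0 := by
        rw [hdiff]
        refine Finset.sum_eq_zero fun j hj => ?_
        obtain ⟨h1, h2⟩ := Finset.mem_Icc.1 hj
        rw [hy _ (by omega) (by omega), sub_self, mul_zero]
      rw [this, abs_zero, mul_zero]
      positivity
    · have hle : |input p α γ (t - n) y x - input p α γ (t - n) y' x| ≤ A := by
        rw [hdiff]
        refine (Finset.abs_sum_le_sum_abs _ _).trans (Finset.sum_le_sum fun j _ => ?_)
        rw [abs_mul]
        refine mul_le_of_le_one_right (abs_nonneg _) ?_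
        generalize y (t - n - (j : ℤ)) = a
        generalize y' (t - n - (j : ℤ)) = b
        fin_cases a <;> fin_cases b <;> norm_num
      have hpow : r ^ n ≤ r ^ k / r ^ p := by
        rw [le_div_iff₀ (by positivity), ← pow_add]
        exact pow_le_pow_of_le_one hr0.le hr1.le (by omega)
      calc |impulse q β n| * |input p α γ (t - n) y x - input p α γ (t - n) y' x|
          ≤ C * ρ ^ n * A := mul_le_mul (hM n 0 0) hle (abs_nonneg _) (by positivity)
        _ = C * A * r ^ n * r ^ n := by rw [hrr]; ring
        _ ≤ C * A * (r ^ k / r ^ p) * r ^ n := by gcongr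
        _ = _ := by ring
  have hgeo := (hasSum_geometric_of_lt_one hr0.le hr1).mul_left (C * A / r ^ p * r ^ k)
  have := tsum_of_norm_bounded hgeo hterm
  rw [(hx.summable_latent hM hρ0 hρ1 y t).tsum_sub (hx.summable_latent hM hρ0 hρ1 y' t)] at this
  refine this.trans (le_of_eq ?_)
  unfold latentConst
  ring

lemma latentConst_nonneg (hC : 0 ≤ C) (hρ1 : ρ < 1) : 0 ≤ latentConst p α C ρ := by
  have hr1 : √ρ < 1 := by rw [Real.sqrt_lt' one_pos]; simpa using hρ1
  have hA0 : 0 ≤ ∑ k ∈ Finset.Icc 1 p, |α k| := Finset.sum_nonneg fun _ _ => abs_nonneg _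
  have : 0 ≤ (1 - √ρ)⁻¹ := inv_nonneg.2 (by linarith)
  unfold latentConst
  positivity

/-- Under a logarithmic moment condition, almost every covariate path is tame. -/
theorem ae_tame {π : Measure (ℤ → EuclideanSpace ℝ (Fin d))} [IsProbabilityMeasure π]
    (hπ : MeasurePreserving shift π π)
    (hint : Integrable (fun x => Real.posLog ‖x 1‖) π) (hρ0 : 0 < ρ) (hρ1 : ρ < 1) :
    ∀ᵐ x ∂π, Tame ρ x := by
  refine ae_all_iff.2 fun t => ?_
  -- This makes `ρ * exp c = √ρ < 1`, so excluding `log⁺ ‖x (t - n)‖ > c * n` by Borel–Cantelli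
  -- leaves a geometric tail.
  set c := -Real.log ρ / 2 with hc
  have hc0 : 0 < c := by have := Real.log_neg hρ0 hρ1; linarith
  have hrate : ρ * Real.exp c < 1 := by
    rw [← Real.exp_log hρ0, ← Real.exp_add, Real.exp_lt_one_iff]
    linarith
  have hmeas : Measurable fun v : EuclideanSpace ℝ (Fin d) => Real.posLog ‖v‖ / c := by
    have : Measurable Real.posLog := by
      unfold Real.posLog
      exact measurable_const.max Real.measurable_log
    exact (this.comp measurable_norm).div_const _
  have hsum : ∑' n : ℕ, π {x | Real.posLog ‖x (t - n)‖ / c ∈ Set.Ioi (n : ℝ)} ≠ ⊤ := by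
    -- Makes `π` the `volume` of `tsum_prob_mem_Ioi_lt_top`; stationarity reduces every coordinate
    -- to the single variable `x 1`.
    let _ : MeasureSpace (ℤ → EuclideanSpace ℝ (Fin d)) := ⟨π⟩
    have h := tsum_prob_mem_Ioi_lt_top (hint.div_const c)
      (fun x => div_nonneg Real.posLog_nonneg hc0.le)
    refine ne_of_lt (lt_of_le_of_lt (le_of_eq ?_) h)
    refine tsum_congr fun n => ?_
    have hB := hmeas (measurableSet_Ioi (a := (n : ℝ)))
    exact (measure_coordinate_eq hπ hB (t - n)).trans (measure_coordinate_eq hπ hB 1).symm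
  filter_upwards [ae_eventually_notMem hsum] with x hx
  refine Summable.of_norm_bounded_eventually_nat
    (summable_geometric_of_lt_one (by positivity) hrate) ?_
  filter_upwards [hx] with n hn
  have hn' : Real.posLog ‖x (t - n)‖ / c ≤ n := not_lt.1 hn
  rw [div_le_iff₀ hc0] at hn'
  have hle : ‖x (t - n)‖ ≤ Real.exp c ^ n := by
    rcases eq_or_ne ‖x (t - n)‖ 0 with h0 | h0
    · rw [h0]; positivity
    · rw [← Real.exp_log (lt_of_le_of_ne (norm_nonneg _) h0.symm), ← Real.exp_nat_mul]
      exact Real.exp_le_exp.2 ((le_max_right _ _).trans hn')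
  rw [Real.norm_eq_abs, abs_of_nonneg (by positivity), mul_pow]
  exact mul_le_mul_of_nonneg_left hle (by positivity)

end Latent

/-! ### Random environments: uniqueness, existence, stationarity. -/

section

/-- The influence of the remote past on the averages of cylinder functions vanishes. -/
def Forgets (g : ℤ → (ℤ → Fin 2) → ℝ) : Prop :=
  ∀ (N : ℤ) (f : (ℤ → Fin 2) → ℝ) (w : ℝ), OscLE f N 0 w → (∀ ε > 0, ∃ K, OscLE f N K ε) →
    ∀ ε > 0, ∃ n₀, ∀ n ≥ n₀, OscLE (back g N n f) (N - n) 0 ε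

lemma integrable_of_abs_le {α : Type*} [MeasurableSpace α] {P : Measure α} [IsFiniteMeasure P]
    {f : α → ℝ} (hf : Measurable f) {c : ℝ} (hc : ∀ a, |f a| ≤ c) : Integrable f P :=
  Integrable.of_bound hf.aestronglyMeasurable c (Eventually.of_forall hc)

lemma abs_back_le {g : ℤ → (ℤ → Fin 2) → ℝ} (h0 : ∀ t y, 0 ≤ g t y) (h1 : ∀ t y, g t y ≤ 1)
    (N : ℤ) {f : (ℤ → Fin 2) → ℝ} {c : ℝ} (hf : ∀ y, |f y| ≤ c) (n : ℕ) (y : ℤ → Fin 2) :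
    |back g N n f y| ≤ c := by
  induction n generalizing y with
  | zero => exact hf y
  | succ n ih =>
    have a1 := abs_le.1 (ih (Function.update y (N - (n + 1)) 1))
    have a0 := abs_le.1 (ih (Function.update y (N - (n + 1)) 0))
    have b0 := h0 (N - (n + 1)) y
    have b1 := h1 (N - (n + 1)) y
    rw [back, step, abs_le]
    constructor <;> nlinarith

lemma binary_val_le_one (i : Fin 2) : |((i : ℕ) : ℝ)| ≤ 1 := by
  fin_cases i <;> norm_num

variable {S : Type*} [MeasurableSpace S]

lemma measurable_response_val (t : ℤ) :
    Measurable fun z : (ℤ → Fin 2) × (ℤ → S) => ((z.1 t : ℕ) : ℝ) :=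
  (Measurable.of_discrete (f := fun i : Fin 2 => ((i : ℕ) : ℝ))).comp
    ((measurable_pi_apply t).comp measurable_fst)

/-- A measurable family of transition probabilities in a random environment. -/
structure IsEnvironmentTransition (G : ℤ → (ℤ → Fin 2) → (ℤ → S) → ℝ) : Prop where
  measurable : ∀ t, Measurable fun z : (ℤ → Fin 2) × (ℤ → S) => G t z.1 z.2
  nonneg : ∀ t y x, 0 ≤ G t y x
  le_one : ∀ t y x, G t y x ≤ 1
  dependsOn : ∀ t x, DependsOn (fun y => G t y x) (Set.Iio t)

/-- Under `Q`, the conditional probability of `y_t = 1` given the past of `y` and the whole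
environment `x` is `G t y x`. -/
def IsCompatible (G : ℤ → (ℤ → Fin 2) → (ℤ → S) → ℝ) (Q : Measure ((ℤ → Fin 2) × (ℤ → S))) :
    Prop :=
  ∀ (t : ℤ) (h : (ℤ → Fin 2) × (ℤ → S) → ℝ) (c : ℝ), Measurable h → (∀ z, |h z| ≤ c) →
    ∫ z, h (trunc t z.1, z.2) * ((z.1 t : ℕ) : ℝ) ∂Q
      = ∫ z, h (trunc t z.1, z.2) * G t z.1 z.2 ∂Q

variable {G : ℤ → (ℤ → Fin 2) → (ℤ → S) → ℝ}

/-- The averages of `f` in the environment `z.2`, evaluated at `z`. -/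
def envBack (G : ℤ → (ℤ → Fin 2) → (ℤ → S) → ℝ) (N : ℤ) (n : ℕ)
    (f : (ℤ → Fin 2) × (ℤ → S) → ℝ) (z : (ℤ → Fin 2) × (ℤ → S)) : ℝ :=
  back (fun t y => G t y z.2) N n (fun y => f (y, z.2)) z.1

lemma measurable_trunc_prod (t : ℤ) :
    Measurable fun z : (ℤ → Fin 2) × (ℤ → S) => (trunc t z.1, z.2) :=
  ((measurable_trunc t).comp measurable_fst).prodMk measurable_snd

lemma measurable_update_prod (t : ℤ) (i : Fin 2) :
    Measurable fun z : (ℤ → Fin 2) × (ℤ → S) => (Function.update z.1 t i, z.2) := by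
  refine Measurable.prodMk ?_ measurable_snd
  refine measurable_pi_lambda _ fun r => ?_
  by_cases h : r = t
  · subst h
    simp
  · simp only [Function.update_of_ne h]
    exact (measurable_pi_apply r).comp measurable_fst

lemma measurable_envBack (hG : IsEnvironmentTransition G) (N : ℤ) (n : ℕ)
    {f : (ℤ → Fin 2) × (ℤ → S) → ℝ} (hf : Measurable f) : Measurable (envBack G N n f) := by
  induction n with
  | zero => exact hf
  | succ n ih =>
    exact ((hG.measurable _).mul (ih.comp (measurable_update_prod _ 1))).add
      ((measurable_const.sub (hG.measurable _)).mul (ih.comp (measurable_update_prod _ 0)))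

/-- Splitting by the value at `t` writes `f` as `f₁ y_t + f₀ (1 - y_t)`, where `f₁` and `f₀` see
only the earlier responses and the environment; compatibility replaces `y_t` by `G t`. -/
lemma IsCompatible.integral_step {Q : Measure ((ℤ → Fin 2) × (ℤ → S))} [IsProbabilityMeasure Q]
    (hQ : IsCompatible G Q) (hG : IsEnvironmentTransition G) {t : ℤ}
    {f : (ℤ → Fin 2) × (ℤ → S) → ℝ} {c : ℝ} (hf : Measurable f) (hc : ∀ z, |f z| ≤ c)
    (hdep : ∀ x, DependsOn (fun y => f (y, x)) (Set.Iio (t + 1))) :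
    ∫ z, f z ∂Q = ∫ z, step (fun y => G t y z.2) t (fun y => f (y, z.2)) z.1 ∂Q := by
  set h : Fin 2 → (ℤ → Fin 2) × (ℤ → S) → ℝ := fun i z => f (Function.update z.1 t i, z.2) with hh
  have hm : ∀ i, Measurable (h i) := fun i => hf.comp (measurable_update_prod t i)
  have hb : ∀ i z, |h i z| ≤ c := fun i z => hc _
  have hupd : ∀ (i : Fin 2) (z : (ℤ → Fin 2) × (ℤ → S)),
      h i (trunc t z.1, z.2) = f (Function.update z.1 t i, z.2) := fun i z =>
    hdep z.2 fun r hr => by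
      by_cases hrt : r = t
      · simp [hrt]
      · simp only [Function.update_of_ne hrt]
        exact trunc_eq t z.1 r (by simp only [Set.mem_Iio] at hr ⊢; omega)
  have hf_eq : ∀ z, f z = h 1 (trunc t z.1, z.2) * ((z.1 t : ℕ) : ℝ) + (h 0 (trunc t z.1, z.2)
      - h 0 (trunc t z.1, z.2) * ((z.1 t : ℕ) : ℝ)) := by
    intro z
    rw [hupd, hupd]
    have hz : f z = f (Function.update z.1 t (z.1 t), z.2) := by simp
    rcases (by omega : z.1 t = 0 ∨ z.1 t = 1) with h | h
    · rw [hz, h]; simp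
    · rw [hz, h]; simp
  have i1 : ∀ i, Integrable (fun z => h i (trunc t z.1, z.2)) Q := fun i =>
    integrable_of_abs_le ((hm i).comp (measurable_trunc_prod t)) fun z => hb i _
  have hmul : ∀ i (k : (ℤ → Fin 2) × (ℤ → S) → ℝ), Measurable k → (∀ z, |k z| ≤ 1) →
      Integrable (fun z => h i (trunc t z.1, z.2) * k z) Q := fun i k hk hk1 =>
    integrable_of_abs_le (((hm i).comp (measurable_trunc_prod t)).mul hk) (c := c) fun z => by
      rw [abs_mul]
      calc _ ≤ c * 1 := mul_le_mul (hb i _) (hk1 z) (abs_nonneg _) ((abs_nonneg _).trans (hb i z))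
        _ = c := mul_one c
  have iv := fun i => hmul i _ (measurable_response_val t) fun z => binary_val_le_one _
  have ig := fun i => hmul i _ (hG.measurable t) fun z =>
    abs_le.2 ⟨by linarith [hG.nonneg t z.1 z.2], hG.le_one t z.1 z.2⟩
  have jv : Integrable (fun z => h 0 (trunc t z.1, z.2)
      - h 0 (trunc t z.1, z.2) * ((z.1 t : ℕ) : ℝ)) Q := (i1 0).sub (iv 0)
  have jg : Integrable (fun z => h 0 (trunc t z.1, z.2)
      - h 0 (trunc t z.1, z.2) * G t z.1 z.2) Q := (i1 0).sub (ig 0)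
  calc ∫ z, f z ∂Q = ∫ z, (h 1 (trunc t z.1, z.2) * ((z.1 t : ℕ) : ℝ) + (h 0 (trunc t z.1, z.2)
      - h 0 (trunc t z.1, z.2) * ((z.1 t : ℕ) : ℝ))) ∂Q :=
        integral_congr_ae (Eventually.of_forall hf_eq)
    _ = ∫ z, (h 1 (trunc t z.1, z.2) * G t z.1 z.2 + (h 0 (trunc t z.1, z.2)
      - h 0 (trunc t z.1, z.2) * G t z.1 z.2)) ∂Q := by
        rw [integral_add (iv 1) jv, integral_sub (i1 0) (iv 0),
          integral_add (ig 1) jg, integral_sub (i1 0) (ig 0),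
          hQ t (h 1) c (hm 1) (hb 1), hQ t (h 0) c (hm 0) (hb 0)]
    _ = _ := by
        refine integral_congr_ae (Eventually.of_forall fun z => ?_)
        simp only [step, hupd]
        ring

lemma IsCompatible.integral_envBack {Q : Measure ((ℤ → Fin 2) × (ℤ → S))}
    [IsProbabilityMeasure Q] (hQ : IsCompatible G Q) (hG : IsEnvironmentTransition G) {N : ℤ}
    {f : (ℤ → Fin 2) × (ℤ → S) → ℝ} {c : ℝ} (hf : Measurable f) (hc : ∀ z, |f z| ≤ c)
    (hdep : ∀ x, DependsOn (fun y => f (y, x)) (Set.Iio N)) (n : ℕ) :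
    ∫ z, f z ∂Q = ∫ z, envBack G N n f z ∂Q := by
  induction n with
  | zero => rfl
  | succ n ih =>
    rw [ih]
    refine hQ.integral_step hG (measurable_envBack hG N n hf)
      (fun z => abs_back_le (fun t y => hG.nonneg t y z.2) (fun t y => hG.le_one t y z.2) N
        (fun y => hc _) n z.1) fun x => ?_
    have := dependsOn_back (g := fun t y => G t y x) (fun t => hG.dependsOn t x) (hdep x) n
    rw [show N - (n + 1 : ℤ) + 1 = N - n by ring]
    exact this

/-- Averaging backwards preserves the integral, and forgetting allows the actual past to be replaced
by the zero past in the limit. The integrals on the left involve `Q` only through its environment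
marginal, which is the source of uniqueness. -/
lemma IsCompatible.tendsto_integral {Q : Measure ((ℤ → Fin 2) × (ℤ → S))}
    [IsProbabilityMeasure Q] (hQ : IsCompatible G Q) (hG : IsEnvironmentTransition G)
    (hforget : ∀ᵐ x ∂(Q.map Prod.snd), Forgets fun t y => G t y x) {N : ℤ}
    {f : (ℤ → Fin 2) × (ℤ → S) → ℝ} {c : ℝ} (hf : Measurable f) (hc : ∀ z, |f z| ≤ c)
    (hosc : ∀ x, ∃ K, OscLE (fun y => f (y, x)) N K 0) :
    Tendsto (fun n => ∫ x, envBack G N n f (0, x) ∂(Q.map Prod.snd)) atTop (𝓝 (∫ z, f z ∂Q)) := by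
  have hosc' : ∀ x, ∀ ε > 0, ∃ K, OscLE (fun y => f (y, x)) N K ε := fun x ε hε => by
    obtain ⟨K, hK⟩ := hosc x
    exact ⟨K, hK.mono le_rfl hε.le⟩
  have hm0 : ∀ n, Measurable fun x : ℤ → S => envBack G N n f (0, x) := fun n =>
    (measurable_envBack hG N n hf).comp (measurable_const.prodMk measurable_id)
  have hb : ∀ n z, |envBack G N n f z| ≤ c := fun n z =>
    abs_back_le (fun t y => hG.nonneg t y z.2) (fun t y => hG.le_one t y z.2) N (fun y => hc _) n z.1
  have hlim : Tendsto (fun n => ∫ z, (envBack G N n f (0, z.2) - envBack G N n f z) ∂Q) atTop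
      (𝓝 (∫ _, (0 : ℝ) ∂Q)) := by
    refine tendsto_integral_of_dominated_convergence (fun _ => 2 * c)
      (fun n => (((hm0 n).comp measurable_snd).sub
        (measurable_envBack hG N n hf)).aestronglyMeasurable) (integrable_const _)
      (fun n => Eventually.of_forall fun z => ?_) ?_
    · have h1 := abs_le.1 (hb n (0, z.2))
      have h2 := abs_le.1 (hb n z)
      rw [Real.norm_eq_abs, abs_le]
      constructor <;> linarith
    · filter_upwards [ae_of_ae_map measurable_snd.aemeasurable hforget] with z hz
      refine Metric.tendsto_atTop.2 fun ε hε => ?_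
      obtain ⟨n₀, hn₀⟩ := hz N (fun y => f (y, z.2)) (2 * c) (fun y y' _ => by
        have h1 := abs_le.1 (hc (y, z.2))
        have h2 := abs_le.1 (hc (y', z.2))
        rw [abs_le]
        constructor <;> linarith) (hosc' z.2) (ε / 2) (half_pos hε)
      refine ⟨n₀, fun n hn => ?_⟩
      rw [Real.dist_eq, sub_zero]
      have := hn₀ n hn 0 z.1 (by intro r; omega)
      exact lt_of_le_of_lt this (by linarith)
  rw [integral_zero] at hlim
  have heq : ∀ n, ∫ z, (envBack G N n f (0, z.2) - envBack G N n f z) ∂Q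
      = ∫ x, envBack G N n f (0, x) ∂(Q.map Prod.snd) - ∫ z, f z ∂Q := by
    intro n
    rw [hQ.integral_envBack hG hf hc (fun x => dependsOn_of_osc (hosc' x)) n,
      integral_map measurable_snd.aemeasurable (hm0 n).aestronglyMeasurable, integral_sub]
    · exact integrable_of_abs_le ((hm0 n).comp measurable_snd) fun z => hb n _
    · exact integrable_of_abs_le (measurable_envBack hG N n hf) (hb n)
  simp only [heq] at hlim
  simpa using hlim.add_const (∫ z, f z ∂Q)

/-- Uniqueness in law of a chain with complete connections in a random environment. -/
theorem IsCompatible.unique {Q Q' : Measure ((ℤ → Fin 2) × (ℤ → S))} [IsProbabilityMeasure Q]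
    [IsProbabilityMeasure Q'] (hQ : IsCompatible G Q) (hQ' : IsCompatible G Q')
    (hG : IsEnvironmentTransition G) (hmarg : Q.map Prod.snd = Q'.map Prod.snd)
    (hforget : ∀ᵐ x ∂(Q.map Prod.snd), Forgets fun t y => G t y x) : Q = Q' := by
  refine ext_of_generate_finite
    (Set.image2 (· ×ˢ ·) (measurableCylinders fun _ : ℤ => Fin 2) {B : Set (ℤ → S) | MeasurableSet B})
    (generateFrom_eq_prod generateFrom_measurableCylinders MeasurableSpace.generateFrom_measurableSet
      ⟨fun _ => Set.univ, fun _ => univ_mem_measurableCylinders _, Set.iUnion_const _⟩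
      isCountablySpanning_measurableSet).symm
    (isPiSystem_measurableCylinders.prod MeasurableSpace.isPiSystem_measurableSet) ?_ (by simp)
  rintro _ ⟨C, hC, B, hB, rfl⟩
  have hB : MeasurableSet B := hB
  obtain ⟨N, -, K, hK⟩ := cylinder_indicator_osc hC
  have hmeas : MeasurableSet (C ×ˢ B) := (MeasurableSet.of_mem_measurableCylinders hC).prod hB
  set f : (ℤ → Fin 2) × (ℤ → S) → ℝ := (C ×ˢ B).indicator 1 with hfdef
  have hf : Measurable f := measurable_one.indicator hmeas
  have hc : ∀ z, |f z| ≤ 1 := fun z => by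
    by_cases h : z ∈ C ×ˢ B
    · rw [hfdef, Set.indicator_of_mem h]; simp
    · rw [hfdef, Set.indicator_of_notMem h]; simp
  have hosc : ∀ x, ∃ K, OscLE (fun y => f (y, x)) N K 0 := by
    intro x
    by_cases hx : x ∈ B
    · have : (fun y => f (y, x)) = C.indicator 1 := by
        funext y
        by_cases hy : y ∈ C <;> simp [hfdef, hx, hy]
      exact ⟨K, this ▸ hK⟩
    · have : (fun y => f (y, x)) = fun _ => 0 := by
        funext y
        simp [hfdef, hx]
      exact ⟨0, fun y y' _ => by rw [this]; simp⟩
  have h1 := hQ.tendsto_integral hG hforget hf hc hosc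
  have h2 := hQ'.tendsto_integral hG (hmarg ▸ hforget) hf hc hosc
  rw [← hmarg] at h2
  have := tendsto_nhds_unique h1 h2
  rw [hfdef, integral_indicator_one hmeas, integral_indicator_one hmeas] at this
  exact (measureReal_eq_measureReal_iff).1 this

/-- In an environment where the chain forgets its past, the compatible measures form a kernel. -/
theorem exists_compatible_kernel {π : Measure (ℤ → S)} (hG : IsEnvironmentTransition G)
    (hgood : ∀ᵐ x ∂π, (∀ t, Continuous fun y => G t y x) ∧ Forgets fun t y => G t y x) :
    ∃ κ : Kernel (ℤ → S) (ℤ → Fin 2), IsMarkovKernel κ ∧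
      ∀ᵐ x ∂π, ∀ (t : ℤ) (h : (ℤ → Fin 2) → ℝ), Measurable h →
        ∫ y, h (trunc t y) * ((y t : ℕ) : ℝ) ∂(κ x) = ∫ y, h (trunc t y) * G t y x ∂(κ x) := by
  classical
  obtain ⟨D, hD, hDm, hDπ⟩ := exists_measurable_superset_of_null hgood
  have hDgood : ∀ x, x ∉ D → (∀ t, Continuous fun y => G t y x) ∧ Forgets fun t y => G t y x :=
    fun x hx => by
      by_contra hcon
      exact hx (hD hcon)
  -- On the exceptional null set the measure is pinned to a Dirac mass, so that the choice is
  -- measurable there as well.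
  have hex : ∀ x, ∃ κ : Measure (ℤ → Fin 2), IsProbabilityMeasure κ ∧ (x ∈ D → κ = Measure.dirac 0) ∧
      (x ∉ D → ∀ t, ∀ f : (ℤ → Fin 2) → ℝ, Continuous f → DependsOn f (Set.Iio (t + 1)) →
        ∫ y, f y ∂κ = ∫ y, step (fun y => G t y x) t f y ∂κ) := by
    intro x
    by_cases hx : x ∈ D
    · exact ⟨Measure.dirac 0, inferInstance, fun _ => rfl, fun h => absurd hx h⟩
    · obtain ⟨κ, h1, h2⟩ := exists_compatible_measure (g := fun t y => G t y x)
        (fun t y => hG.nonneg t y x) (fun t y => hG.le_one t y x) (hDgood x hx).1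
        (fun t => hG.dependsOn t x)
      exact ⟨κ, h1, fun h => absurd h hx, fun _ => h2⟩
  choose κ hκp hκD hκ using hex
  have hmeas : Measurable κ := by
    refine Measurable.measure_of_isPiSystem_of_isProbabilityMeasure
      generateFrom_measurableCylinders.symm isPiSystem_measurableCylinders fun C hC => ?_
    obtain ⟨N, hosc0, K, hK⟩ := cylinder_indicator_osc hC
    have hCm : MeasurableSet C := MeasurableSet.of_mem_measurableCylinders hC
    have hosc : ∀ ε > 0, ∃ K, OscLE (C.indicator (1 : (ℤ → Fin 2) → ℝ)) N K ε :=
      fun ε hε => ⟨K, hK.mono le_rfl hε.le⟩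
    have hcont : Continuous (C.indicator (1 : (ℤ → Fin 2) → ℝ)) := continuous_of_osc hosc
    -- Although `κ x` was chosen arbitrarily, forgetting makes its values on cylinders limits of
    -- averages started from the zero past, which are measurable in `x`.
    have hreal : Measurable fun x => (κ x).real C := by
      refine measurable_of_tendsto_metrizable
        (f := fun (n : ℕ) x => if x ∈ D then C.indicator (1 : (ℤ → Fin 2) → ℝ) 0 else
          back (fun t y => G t y x) N n (C.indicator (1 : (ℤ → Fin 2) → ℝ)) 0) (fun n => ?_) ?_
      · refine Measurable.ite hDm measurable_const ?_
        exact (measurable_envBack hG N n (f := fun z => C.indicator (1 : (ℤ → Fin 2) → ℝ) z.1)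
          ((measurable_one.indicator hCm).comp measurable_fst)).comp
          (measurable_const.prodMk measurable_id)
      · refine tendsto_pi_nhds.2 fun x => ?_
        by_cases hx : x ∈ D
        · simp only [hx, if_true]
          rw [hκD x hx, ← integral_indicator_one hCm, integral_dirac]
          exact tendsto_const_nhds
        · simp only [hx, if_false]
          have hgc := hDgood x hx
          refine Metric.tendsto_atTop.2 fun ε hε => ?_
          obtain ⟨n₀, hn₀⟩ := hgc.2 N _ 1 hosc0 hosc (ε / 2) (half_pos hε)
          refine ⟨n₀, fun n hn => ?_⟩
          have hback : Continuous (back (fun t y => G t y x) N n (C.indicator 1)) :=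
            continuous_back hgc.1 N hcont n
          rw [← integral_indicator_one hCm, integral_eq_integral_back
            (g := fun t y => G t y x) hgc.1 (fun t => hG.dependsOn t x) (hκ x hx) hcont
            (dependsOn_of_osc hosc) n, dist_comm, dist_eq_norm]
          have hp := hκp x
          have hint : Integrable (back (fun t y => G t y x) N n (C.indicator 1)) (κ x) :=
            hback.integrable_of_hasCompactSupport (HasCompactSupport.of_compactSpace _)
          have := norm_integral_le_of_norm_le_const (μ := κ x)
            (f := fun y => back (fun t y => G t y x) N n (C.indicator 1) y
              - back (fun t y => G t y x) N n (C.indicator 1) 0) (C := ε / 2)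
            (Eventually.of_forall fun y => hn₀ n hn y 0 (by intro r; omega))
          rw [integral_sub hint (integrable_const _), integral_const] at this
          simp only [probReal_univ, mul_one, one_smul] at this
          exact lt_of_le_of_lt this (by linarith)
    have : (fun x => κ x C) = fun x => ENNReal.ofReal ((κ x).real C) := by
      funext x
      have := hκp x
      rw [ofReal_measureReal]
    rw [this]
    exact hreal.ennreal_ofReal
  refine ⟨⟨κ, hmeas⟩, ⟨hκp⟩, ?_⟩
  have hDae : ∀ᵐ x ∂π, x ∉ D := measure_eq_zero_iff_ae_notMem.1 hDπ
  filter_upwards [hDae] with x hx t h hh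
  have := hκp x
  exact integral_trunc_eq (g := fun t y => G t y x) (fun t y => hG.nonneg t y x)
    (fun t y => hG.le_one t y x) (hDgood x hx).1 (hκ x hx) t hh

/-- Existence of a chain with complete connections in a random environment. -/
theorem exists_compatible {Ω₀ : Type*} [MeasurableSpace Ω₀] (P₀ : Measure Ω₀)
    [IsProbabilityMeasure P₀] {X : Ω₀ → ℤ → S} (hX : Measurable X)
    (hG : IsEnvironmentTransition G)
    (hgood : ∀ᵐ x ∂(P₀.map X), (∀ t, Continuous fun y => G t y x) ∧ Forgets fun t y => G t y x) :
    ∃ P : Measure ((ℤ → Fin 2) × Ω₀), IsProbabilityMeasure P ∧ P.map Prod.snd = P₀ ∧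
      IsCompatible G (P.map (Prod.map id X)) := by
  obtain ⟨κ, hκp, hκ⟩ := exists_compatible_kernel hG hgood
  have hκ' := ae_of_ae_map hX.aemeasurable hκ
  set P : Measure ((ℤ → Fin 2) × Ω₀) := (P₀ ⊗ₘ (κ.comap X hX)).map Prod.swap with hP
  have hprob : IsProbabilityMeasure P := Measure.isProbabilityMeasure_map measurable_swap.aemeasurable
  refine ⟨P, hprob, ?_, ?_⟩
  · rw [hP, Measure.map_map measurable_snd measurable_swap]
    exact Measure.fst_compProd P₀ _
  · intro t h c hh hc
    have hmX : Measurable (Prod.map id X : (ℤ → Fin 2) × Ω₀ → _) := measurable_id.prodMap hX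
    have key : ∀ {f : (ℤ → Fin 2) × (ℤ → S) → ℝ}, Measurable f → (∀ z, |f z| ≤ c) →
        ∫ z, f z ∂(P.map (Prod.map id X)) = ∫ ω, ∫ y, f (y, X ω) ∂(κ (X ω)) ∂P₀ := by
      intro f hf hfc
      rw [integral_map hmX.aemeasurable hf.aestronglyMeasurable, hP,
        integral_map (f := fun z => f (Prod.map id X z)) measurable_swap.aemeasurable
          (hf.comp hmX).aestronglyMeasurable,
        Measure.integral_compProd
          (f := fun z => f (Prod.map id X z.swap))
          (integrable_of_abs_le ((hf.comp hmX).comp measurable_swap) fun z => hfc _)]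
      rfl
    have hhm : Measurable fun z : (ℤ → Fin 2) × (ℤ → S) => h (trunc t z.1, z.2) :=
      hh.comp (measurable_trunc_prod t)
    have hmul : ∀ {k : (ℤ → Fin 2) × (ℤ → S) → ℝ}, (∀ z, |k z| ≤ 1) →
        ∀ z, |h (trunc t z.1, z.2) * k z| ≤ c := fun hk z => by
      rw [abs_mul]
      calc _ ≤ c * 1 := mul_le_mul (hc _) (hk z) (abs_nonneg _) ((abs_nonneg _).trans (hc z))
        _ = c := mul_one c
    rw [key (f := fun z => h (trunc t z.1, z.2) * ((z.1 t : ℕ) : ℝ))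
        (hhm.mul (measurable_response_val t)) (hmul fun z => binary_val_le_one _),
      key (f := fun z => h (trunc t z.1, z.2) * G t z.1 z.2) (hhm.mul (hG.measurable t)) (hmul fun z =>
        abs_le.2 ⟨by linarith [hG.nonneg t z.1 z.2], hG.le_one t z.1 z.2⟩)]
    refine integral_congr_ae ?_
    filter_upwards [hκ'] with ω hω
    exact hω t (fun y => h (y, X ω)) (hh.comp (measurable_id.prodMk measurable_const))

lemma trunc_shift (t : ℤ) (y : ℤ → Fin 2) : trunc t (shift y) = shift (trunc (t + 1) y) := by
  funext r
  simp [trunc, shift]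

lemma measurable_shift_prod :
    Measurable (Prod.map shift shift : (ℤ → Fin 2) × (ℤ → S) → (ℤ → Fin 2) × (ℤ → S)) :=
  measurable_shift.prodMap measurable_shift

lemma IsCompatible.map_shift {Q : Measure ((ℤ → Fin 2) × (ℤ → S))}
    (hQ : IsCompatible G Q) (hG : IsEnvironmentTransition G)
    (hshift : ∀ t y x, G t (shift y) (shift x) = G (t + 1) y x) :
    IsCompatible G (Q.map (Prod.map shift shift)) := by
  intro t h c hh hc
  have hhm : Measurable fun z : (ℤ → Fin 2) × (ℤ → S) => h (trunc t z.1, z.2) :=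
    hh.comp (measurable_trunc_prod t)
  rw [integral_map (f := fun z => h (trunc t z.1, z.2) * ((z.1 t : ℕ) : ℝ))
      measurable_shift_prod.aemeasurable (hhm.mul (measurable_response_val t)).aestronglyMeasurable,
    integral_map (f := fun z => h (trunc t z.1, z.2) * G t z.1 z.2)
      measurable_shift_prod.aemeasurable (hhm.mul (hG.measurable t)).aestronglyMeasurable]
  have := hQ (t + 1) (fun z => h (shift z.1, shift z.2)) c (hh.comp measurable_shift_prod)
    fun z => hc _
  have hval : ∀ y : ℤ → Fin 2, shift y t = y (t + 1) := fun _ => rfl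
  simpa only [Prod.map_fst, Prod.map_snd, trunc_shift, hshift, hval] using this

/-- The law of a chain with complete connections in a stationary environment is stationary. -/
theorem IsCompatible.measurePreserving {Q : Measure ((ℤ → Fin 2) × (ℤ → S))}
    [IsProbabilityMeasure Q] (hQ : IsCompatible G Q) (hG : IsEnvironmentTransition G)
    (hshift : ∀ t y x, G t (shift y) (shift x) = G (t + 1) y x)
    (hπ : MeasurePreserving shift (Q.map Prod.snd) (Q.map Prod.snd))
    (hforget : ∀ᵐ x ∂(Q.map Prod.snd), Forgets fun t y => G t y x) :
    MeasurePreserving (Prod.map shift shift) Q Q := by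
  have : IsProbabilityMeasure (Q.map (Prod.map shift shift)) :=
    Measure.isProbabilityMeasure_map measurable_shift_prod.aemeasurable
  -- The shifted law is compatible and has the same environment marginal, so uniqueness applies.
  refine ⟨measurable_shift_prod, (hQ.unique (hQ.map_shift hG hshift) hG ?_ hforget).symm⟩
  rw [Measure.map_map measurable_snd measurable_shift_prod]
  conv_lhs => rw [← hπ.map_eq, Measure.map_map measurable_shift measurable_snd]
  rfl

end

/-! ### Ergodicity in an ergodic environment. -/

section

variable {S : Type*} [MeasurableSpace S]

lemma trunc_trunc_of_le {s t : ℤ} (h : s ≤ t) (y : ℤ → Fin 2) : trunc s (trunc t y) = trunc s y :=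
  trunc_congr fun r hr => trunc_eq t y r (lt_of_lt_of_le hr h)

/-- The events that depend only on the environment and on the responses up to some time. -/
def pastEvents (S : Type*) [MeasurableSpace S] : Set (Set ((ℤ → Fin 2) × (ℤ → S))) :=
  {B | ∃ N : ℕ, ∃ D, MeasurableSet D ∧ B = (fun z => (trunc N z.1, z.2)) ⁻¹' D}

/-- Together with `generateFrom_pastEvents` this makes the past events dense in measure, hence able
to approximate an invariant event. -/
lemma isSetAlgebra_pastEvents : IsSetAlgebra (pastEvents S) where
  empty_mem := ⟨0, ∅, MeasurableSet.empty, rfl⟩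
  compl_mem := by
    rintro _ ⟨N, D, hD, rfl⟩
    exact ⟨N, Dᶜ, hD.compl, rfl⟩
  union_mem := by
    rintro _ _ ⟨N, D, hD, rfl⟩ ⟨N', D', hD', rfl⟩
    refine ⟨max N N', (fun z => (trunc N z.1, z.2)) ⁻¹' D ∪ (fun z => (trunc N' z.1, z.2)) ⁻¹' D',
      (measurable_trunc_prod _ hD).union (measurable_trunc_prod _ hD'), ?_⟩
    ext z
    simp only [Set.mem_union, Set.mem_preimage]
    rw [trunc_trunc_of_le (by exact_mod_cast le_max_left N N'),
      trunc_trunc_of_le (by exact_mod_cast le_max_right N N')]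

lemma generateFrom_pastEvents :
    (Prod.instMeasurableSpace : MeasurableSpace ((ℤ → Fin 2) × (ℤ → S)))
      = MeasurableSpace.generateFrom (pastEvents S) := by
  refine le_antisymm ?_ (MeasurableSpace.generateFrom_le ?_)
  · refine sup_le ?_ ?_
    · rw [← measurable_iff_comap_le]
      refine @measurable_pi_lambda _ _ _ (_) _ _ fun r => ?_
      intro A hA
      refine MeasurableSpace.measurableSet_generateFrom
        ⟨r.natAbs + 1, _, (measurable_pi_apply r).comp measurable_fst hA, ?_⟩
      ext z
      have : trunc ((r.natAbs + 1 : ℕ) : ℤ) z.1 r = z.1 r :=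
        trunc_eq _ _ r (by simp only [Set.mem_Iio]; omega)
      simp only [Set.mem_preimage, Function.comp, this]
    · rintro _ ⟨B, hB, rfl⟩
      exact MeasurableSpace.measurableSet_generateFrom ⟨0, _, measurable_snd hB, rfl⟩
  · rintro _ ⟨N, D, hD, rfl⟩
    exact measurable_trunc_prod _ hD

variable {G : ℤ → (ℤ → Fin 2) → (ℤ → S) → ℝ}

/-- A shift-invariant event is a limit of events in the remote past, so conditioning on it does not
change the transition probabilities. -/
lemma IsCompatible.cond_invariant {Q : Measure ((ℤ → Fin 2) × (ℤ → S))} [IsProbabilityMeasure Q]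
    (hQ : IsCompatible G Q) (hG : IsEnvironmentTransition G)
    (hT : MeasurePreserving (Prod.map shift shift) Q Q) {s : Set ((ℤ → Fin 2) × (ℤ → S))}
    (hs : MeasurableSet s) (hinv : Prod.map shift shift ⁻¹' s = s) : IsCompatible G Q[|s] := by
  intro t h c hh hc
  set e : ((ℤ → Fin 2) × (ℤ → S)) ≃ᵐ ((ℤ → Fin 2) × (ℤ → S)) :=
    (shiftEquiv (Fin 2)).prodCongr (shiftEquiv S) with he
  have hsymm : MeasurePreserving e.symm Q Q := MeasurePreserving.symm e hT
  have hinv' : Function.IsFixedPt (Set.preimage e.symm) s := by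
    change e.symm ⁻¹' s = s
    conv_lhs => rw [← hinv]
    ext z
    exact iff_of_eq (congrArg (· ∈ s) (e.apply_symm_apply z))
  have hhm : Measurable fun z : (ℤ → Fin 2) × (ℤ → S) => h (trunc t z.1, z.2) :=
    hh.comp (measurable_trunc_prod t)
  -- A martingale difference: its integral vanishes over events determined by the environment and
  -- the responses before `t`. The aim is the same over `s`.
  set k : (ℤ → Fin 2) × (ℤ → S) → ℝ := fun z =>
    h (trunc t z.1, z.2) * (((z.1 t : ℕ) : ℝ) - G t z.1 z.2) with hk
  have hkm : Measurable k := hhm.mul ((measurable_response_val t).sub (hG.measurable t))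
  have hkc : ∀ z, |k z| ≤ |c| := fun z => by
    have h1 := abs_le.1 (binary_val_le_one (z.1 t))
    have h0 : (0 : ℝ) ≤ ((z.1 t : ℕ) : ℝ) := by positivity
    have h2 := hG.nonneg t z.1 z.2
    have h3 := hG.le_one t z.1 z.2
    rw [hk, abs_mul]
    calc |h (trunc t z.1, z.2)| * |((z.1 t : ℕ) : ℝ) - G t z.1 z.2| ≤ |c| * 1 :=
          mul_le_mul ((hc _).trans (le_abs_self c)) (abs_le.2 ⟨by linarith, by linarith⟩)
            (abs_nonneg _) (abs_nonneg _)
      _ = |c| := mul_one _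
  have hsub : ∀ (P : Measure ((ℤ → Fin 2) × (ℤ → S))) [IsFiniteMeasure P]
      (f : (ℤ → Fin 2) × (ℤ → S) → ℝ), Measurable f → (∀ z, |f z| ≤ |c|) →
      ∫ z, f z * (((z.1 t : ℕ) : ℝ) - G t z.1 z.2) ∂P
        = ∫ z, f z * ((z.1 t : ℕ) : ℝ) ∂P - ∫ z, f z * G t z.1 z.2 ∂P := by
    intro P _ f hf hfc
    have hmul : ∀ {a : (ℤ → Fin 2) × (ℤ → S) → ℝ}, Measurable a → (∀ z, |a z| ≤ 1) →
        Integrable (fun z => f z * a z) P := fun ha ha1 =>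
      integrable_of_abs_le (hf.mul ha) (c := |c|) fun z => by
        rw [abs_mul]
        exact (mul_le_of_le_one_right (abs_nonneg _) (ha1 z)).trans (hfc z)
    rw [← integral_sub (hmul (measurable_response_val t) fun z => binary_val_le_one _)
      (hmul (hG.measurable t) fun z =>
        abs_le.2 ⟨by linarith [hG.nonneg t z.1 z.2], hG.le_one t z.1 z.2⟩)]
    simp only [mul_sub]
  have hpast : ∀ B : Set ((ℤ → Fin 2) × (ℤ → S)), MeasurableSet B →
      (∀ z, (trunc t z.1, z.2) ∈ B ↔ z ∈ B) → ∫ z, B.indicator k z ∂Q = 0 := by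
    intro B hB hBt
    have hbd : ∀ z, |B.indicator h z| ≤ c := fun z => by
      by_cases hz : z ∈ B
      · simpa [hz] using hc z
      · simpa [hz] using (abs_nonneg _).trans (hc z)
    have h1 := hQ t (B.indicator h) c (hh.indicator hB) hbd
    have h2 := hsub Q (fun z => B.indicator h (trunc t z.1, z.2))
      ((hh.indicator hB).comp (measurable_trunc_prod t)) fun z => (hbd _).trans (le_abs_self c)
    rw [h1, sub_self] at h2
    rw [← h2]
    refine integral_congr_ae (Eventually.of_forall fun z => ?_)
    by_cases hz : z ∈ B
    · simp [hz, (hBt z).2 hz, hk]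
    · simp [hz, mt (hBt z).1 hz]
  have hzero : ∫ z in s, k z ∂Q = 0 := by
    rw [← integral_indicator hs]
    have hsmall : ∀ ε > 0, |∫ z, s.indicator k z ∂Q| ≤ |c| * ε := by
      intro ε hε
      obtain ⟨_, ⟨N, D, hD, rfl⟩, hB⟩ :=
        (Measure.MeasureDense.of_generateFrom_isSetAlgebra_finite Q isSetAlgebra_pastEvents
          generateFrom_pastEvents).approx s hs (measure_ne_top _ _) ε hε
      set B : Set ((ℤ → Fin 2) × (ℤ → S)) := (fun z => (trunc N z.1, z.2)) ⁻¹' D with hBdef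
      have hBm : MeasurableSet B := measurable_trunc_prod _ hD
      set n := ((N : ℤ) - t).toNat with hn
      have hmn := hsymm.iterate n
      set B' := e.symm^[n] ⁻¹' B with hB'
      have hB'm : MeasurableSet B' := hmn.measurable hBm
      have hiter : ∀ z, e.symm^[n] z
          = ((shiftEquiv (Fin 2)).symm^[n] z.1, (shiftEquiv S).symm^[n] z.2) := fun z => by
        have : (e.symm : (ℤ → Fin 2) × (ℤ → S) → _)
            = Prod.map (shiftEquiv (Fin 2)).symm (shiftEquiv S).symm := rfl
        rw [this, Prod.map_iterate]
        rfl
      have hB't : ∀ z, (trunc t z.1, z.2) ∈ B' ↔ z ∈ B' := fun z => by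
        simp only [hB', hBdef, Set.mem_preimage, hiter]
        rw [trunc_congr (t := (N : ℤ)) (y' := (shiftEquiv (Fin 2)).symm^[n] z.1)]
        intro r hr
        rw [shiftEquiv_symm_iterate, shiftEquiv_symm_iterate]
        exact trunc_eq t z.1 _ (by simp only [Set.mem_Iio] at hr ⊢; omega)
      have hsymmDiff : symmDiff s B' = e.symm^[n] ⁻¹' (symmDiff s B) := by
        rw [Set.preimage_symmDiff, ← hB', (hinv'.preimage_iterate n : e.symm^[n] ⁻¹' s = s)]
      have hle : Q.real (symmDiff s B') ≤ ε := by
        rw [hsymmDiff, measureReal_def,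
          hmn.measure_preimage (hs.symmDiff hBm).nullMeasurableSet]
        exact ENNReal.toReal_le_of_le_ofReal hε.le hB.le
      have hind : ∀ A : Set ((ℤ → Fin 2) × (ℤ → S)), MeasurableSet A →
          Integrable (A.indicator k) Q := fun A hA =>
        (integrable_of_abs_le hkm hkc).indicator hA
      have h0 := hpast B' hB'm hB't
      calc |∫ z, s.indicator k z ∂Q|
          = |∫ z, (s.indicator k z - B'.indicator k z) ∂Q| := by
            rw [integral_sub (hind s hs) (hind B' hB'm), h0, sub_zero]
        _ ≤ ∫ z, |s.indicator k z - B'.indicator k z| ∂Q := abs_integral_le_integral_abs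
        _ ≤ ∫ z, (symmDiff s B').indicator (fun _ => |c|) z ∂Q := by
            refine integral_mono ((hind s hs).sub (hind B' hB'm)).abs
              ((integrable_const _).indicator (hs.symmDiff hB'm)) fun z => ?_
            by_cases h1 : z ∈ s <;> by_cases h2 : z ∈ B' <;>
              simp [h1, h2, Set.mem_symmDiff, hkc z]
        _ = |c| * Q.real (symmDiff s B') := by
            rw [integral_indicator_const _ (hs.symmDiff hB'm), smul_eq_mul, mul_comm]
        _ ≤ |c| * ε := mul_le_mul_of_nonneg_left hle (abs_nonneg _)
    have hlim : Tendsto (fun ε : ℝ => |c| * ε) (𝓝[>] 0) (𝓝 0) := by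
      have : Tendsto (fun ε : ℝ => |c| * ε) (𝓝 0) (𝓝 (|c| * 0)) := tendsto_id.const_mul _
      rw [mul_zero] at this
      exact this.mono_left nhdsWithin_le_nhds
    exact abs_eq_zero.1 (le_antisymm
      (ge_of_tendsto hlim (eventually_nhdsWithin_of_forall fun ε hε => hsmall ε hε))
      (abs_nonneg _))
  have hcond := hsub (Q.restrict s) (fun z => h (trunc t z.1, z.2)) hhm
    fun z => (hc _).trans (le_abs_self c)
  rw [show ∫ z, h (trunc t z.1, z.2) * (((z.1 t : ℕ) : ℝ) - G t z.1 z.2) ∂(Q.restrict s) = 0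
    from hzero] at hcond
  rw [ProbabilityTheory.cond, integral_smul_measure, integral_smul_measure]
  congr 1
  linarith

/-- The law of a chain with complete connections in an ergodic environment is ergodic. -/
theorem IsCompatible.ergodic {Q : Measure ((ℤ → Fin 2) × (ℤ → S))} [IsProbabilityMeasure Q]
    (hQ : IsCompatible G Q) (hG : IsEnvironmentTransition G)
    (hshift : ∀ t y x, G t (shift y) (shift x) = G (t + 1) y x)
    (hπ : Ergodic shift (Q.map Prod.snd))
    (hforget : ∀ᵐ x ∂(Q.map Prod.snd), Forgets fun t y => G t y x) :
    Ergodic (Prod.map shift shift) Q := by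
  have hT := hQ.measurePreserving hG hshift hπ.toMeasurePreserving hforget
  refine ⟨hT, ⟨fun s hs hinv => ?_⟩⟩
  rw [eventuallyConst_set']
  by_cases h0 : Q s = 0
  · exact Or.inl (ae_eq_empty.2 h0)
  · right
    have hR := hQ.cond_invariant hG hT hs hinv
    have hRp : IsProbabilityMeasure Q[|s] := cond_isProbabilityMeasure h0
    have hRT : MeasurePreserving (Prod.map shift shift) Q[|s] Q[|s] := by
      refine MeasurePreserving.smul_measure ?_ _
      have := hT.restrict_preimage hs
      rwa [hinv] at this
    have hsnd : MeasurePreserving Prod.snd Q[|s] (Q[|s].map Prod.snd) :=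
      measurable_snd.measurePreserving _
    have hRπ : MeasurePreserving shift (Q[|s].map Prod.snd) (Q[|s].map Prod.snd) :=
      hsnd.of_semiconj hRT (fun _ => rfl) measurable_shift
    have hac : Q[|s].map Prod.snd ≪ Q.map Prod.snd :=
      (cond_absolutelyContinuous).map measurable_snd
    have : IsProbabilityMeasure (Q.map Prod.snd) :=
      Measure.isProbabilityMeasure_map measurable_snd.aemeasurable
    have : IsProbabilityMeasure (Q[|s].map Prod.snd) :=
      Measure.isProbabilityMeasure_map measurable_snd.aemeasurable
    -- An invariant probability absolutely continuous with respect to an ergodic one equals it, so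
    -- `Q[|s]` and `Q` share their environment marginal.
    have heq := hQ.unique hR hG (hπ.eq_of_absolutelyContinuous hRπ hac).symm hforget
    refine eventuallyEq_univ.2 ?_
    rw [mem_ae_iff, heq, cond_apply hs]
    simp

end

/-! ### Compatibility in terms of conditional expectations. -/

section Solution

variable {Ω : Type*} {S : Type*} [MeasurableSpace S]

lemma measurable_past (Y : ℤ → Ω → Fin 2) (X : ℤ → Ω → S) {s t : ℤ} (hst : s < t) :
    Measurable[pastAndCovariates Y X t] (Y s) :=
  measurable_iff_comap_le.2 (le_sup_of_le_left
    (le_iSup (fun s : {s : ℤ // s < t} => MeasurableSpace.comap (Y s) inferInstance) ⟨s, hst⟩))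

lemma measurable_covariates (Y : ℤ → Ω → Fin 2) (X : ℤ → Ω → S) (s t : ℤ) :
    Measurable[pastAndCovariates Y X t] (X s) :=
  measurable_iff_comap_le.2 (le_sup_of_le_right
    (le_iSup (fun s : ℤ => MeasurableSpace.comap (X s) inferInstance) s))

lemma measurable_trunc_pair (Y : ℤ → Ω → Fin 2) (X : ℤ → Ω → S) (t : ℤ) :
    Measurable[pastAndCovariates Y X t]
      fun ω => ((trunc t fun s => Y s ω, fun s => X s ω) : (ℤ → Fin 2) × (ℤ → S)) := by
  refine Measurable.prodMk ?_ ?_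
  · refine @measurable_pi_lambda _ _ _ (pastAndCovariates Y X t) _ _ fun r => ?_
    by_cases hr : r < t
    · simpa [trunc, hr] using measurable_past Y X hr
    · simp [trunc, hr]
  · exact @measurable_pi_lambda _ _ _ (pastAndCovariates Y X t) _ _ fun r =>
      measurable_covariates Y X r t

/-- With `measurable_trunc_pair`, this identifies the conditioning σ-algebra with the one generated
by the truncated pair, which justifies the test functions in `IsCompatible`. -/
lemma pastAndCovariates_le_comap (Y : ℤ → Ω → Fin 2) (X : ℤ → Ω → S) (t : ℤ) :
    pastAndCovariates Y X t ≤ MeasurableSpace.comap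
      (fun ω => ((trunc t fun s => Y s ω, fun s => X s ω) : (ℤ → Fin 2) × (ℤ → S)))
      inferInstance := by
  refine sup_le (iSup_le fun s => ?_) (iSup_le fun s => ?_)
  · rintro _ ⟨A, hA, rfl⟩
    refine ⟨_, (measurable_pi_apply (s : ℤ)).comp measurable_fst hA, ?_⟩
    ext ω
    simp [trunc_eq t _ (s : ℤ) s.2]
  · rintro _ ⟨A, hA, rfl⟩
    exact ⟨_, (measurable_pi_apply s).comp measurable_snd hA, rfl⟩

lemma indicator_response (Y : ℤ → Ω → Fin 2) (t : ℤ) :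
    Set.indicator {ω | Y t ω = 1} (fun _ => (1 : ℝ)) = fun ω => ((Y t ω : ℕ) : ℝ) := by
  funext ω
  rcases (by omega : Y t ω = 0 ∨ Y t ω = 1) with h | h <;> simp [h]

variable [mΩ : MeasurableSpace Ω]

lemma measurable_pair {Y : ℤ → Ω → Fin 2} {X : ℤ → Ω → S} (hY : ∀ t, Measurable (Y t))
    (hX : ∀ t, Measurable (X t)) :
    Measurable fun ω => ((fun t => Y t ω, fun t => X t ω) : (ℤ → Fin 2) × (ℤ → S)) :=
  (measurable_pi_lambda _ hY).prodMk (measurable_pi_lambda _ hX)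

lemma pastAndCovariates_le {Y : ℤ → Ω → Fin 2} {X : ℤ → Ω → S} (hY : ∀ t, Measurable (Y t))
    (hX : ∀ t, Measurable (X t)) (t : ℤ) : pastAndCovariates Y X t ≤ mΩ :=
  sup_le (iSup_le fun s => (hY s).comap_le) (iSup_le fun s => (hX s).comap_le)

lemma measurable_response_real {Y : ℤ → Ω → Fin 2} (hY : ∀ t, Measurable (Y t)) (t : ℤ) :
    Measurable fun ω => ((Y t ω : ℕ) : ℝ) :=
  (Measurable.of_discrete (f := fun i : Fin 2 => ((i : ℕ) : ℝ))).comp (hY t)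

lemma integral_mul_of_condExp {P : Measure Ω} [IsProbabilityMeasure P] {Y : ℤ → Ω → Fin 2}
    {X : ℤ → Ω → S} (hY : ∀ t, Measurable (Y t)) (hX : ∀ t, Measurable (X t)) {t : ℤ}
    {k : Ω → ℝ}
    (hk : P[Set.indicator {ω | Y t ω = 1} (fun _ => (1 : ℝ)) | pastAndCovariates Y X t] =ᵐ[P] k)
    {h : (ℤ → Fin 2) × (ℤ → S) → ℝ} {c : ℝ} (hh : Measurable h) (hc : ∀ z, |h z| ≤ c) :
    ∫ ω, h (trunc t fun s => Y s ω, fun s => X s ω) * ((Y t ω : ℕ) : ℝ) ∂P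
      = ∫ ω, h (trunc t fun s => Y s ω, fun s => X s ω) * k ω ∂P := by
  have hm := pastAndCovariates_le hY hX t
  rw [indicator_response] at hk
  have hH : StronglyMeasurable[pastAndCovariates Y X t]
      fun ω => h (trunc t fun s => Y s ω, fun s => X s ω) :=
    (hh.comp (measurable_trunc_pair Y X t)).stronglyMeasurable
  have hYint : Integrable (fun ω => ((Y t ω : ℕ) : ℝ)) P :=
    integrable_of_abs_le (measurable_response_real hY t) fun ω => binary_val_le_one _
  have hpull := condExp_stronglyMeasurable_mul_of_bound hm hH hYint c
    (Eventually.of_forall fun ω => hc _)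
  have h1 := integral_condExp hm (μ := P)
    (f := (fun ω => h (trunc t fun s => Y s ω, fun s => X s ω)) * fun ω => ((Y t ω : ℕ) : ℝ))
  change _ = ∫ ω, h (trunc t fun s => Y s ω, fun s => X s ω) * ((Y t ω : ℕ) : ℝ) ∂P at h1
  rw [← h1]
  refine integral_congr_ae ?_
  filter_upwards [hpull, hk] with ω h2 h3
  rw [h2, Pi.mul_apply, h3]

lemma condExp_of_isCompatible {P : Measure Ω} [IsProbabilityMeasure P] {Y : ℤ → Ω → Fin 2}
    {X : ℤ → Ω → S} (hY : ∀ t, Measurable (Y t)) (hX : ∀ t, Measurable (X t))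
    {G : ℤ → (ℤ → Fin 2) → (ℤ → S) → ℝ} (hG : IsEnvironmentTransition G)
    (hQ : IsCompatible G (P.map fun ω => (fun t => Y t ω, fun t => X t ω))) (t : ℤ) :
    P[Set.indicator {ω | Y t ω = 1} (fun _ => (1 : ℝ)) | pastAndCovariates Y X t]
      =ᵐ[P] fun ω => G t (fun s => Y s ω) (fun s => X s ω) := by
  have hm := pastAndCovariates_le hY hX t
  have hpair := measurable_pair hY hX
  rw [indicator_response]
  have hGtr : (fun ω => G t (fun s => Y s ω) (fun s => X s ω))
      = fun ω => G t (trunc t fun s => Y s ω) (fun s => X s ω) := by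
    funext ω
    exact ((hG.dependsOn t fun s => X s ω).apply_trunc fun s => Y s ω).symm
  have hGint : Integrable (fun ω => G t (fun s => Y s ω) (fun s => X s ω)) P :=
    integrable_of_abs_le ((hG.measurable t).comp hpair) (c := 1) fun ω =>
      abs_le.2 ⟨by linarith [hG.nonneg t (fun s => Y s ω) (fun s => X s ω)], hG.le_one _ _ _⟩
  refine (ae_eq_condExp_of_forall_setIntegral_eq hm
    (integrable_of_abs_le (measurable_response_real hY t) fun ω => binary_val_le_one _)
    (fun s _ _ => hGint.integrableOn) (fun A hA _ => ?_) ?_).symm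
  · obtain ⟨D, hD, rfl⟩ := pastAndCovariates_le_comap Y X t A hA
    have hc : ∀ z, |D.indicator (1 : (ℤ → Fin 2) × (ℤ → S) → ℝ) z| ≤ 1 := fun z => by
      by_cases hz : z ∈ D <;> simp [hz]
    have h1m : Measurable (D.indicator (1 : (ℤ → Fin 2) × (ℤ → S) → ℝ)) := measurable_one.indicator hD
    have := hQ t (D.indicator 1) 1 h1m hc
    have h2m : Measurable fun z : (ℤ → Fin 2) × (ℤ → S) =>
        D.indicator (1 : (ℤ → Fin 2) × (ℤ → S) → ℝ) (trunc t z.1, z.2) :=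
      h1m.comp (measurable_trunc_prod t)
    rw [integral_map (f := fun z => D.indicator 1 (trunc t z.1, z.2) * ((z.1 t : ℕ) : ℝ))
        hpair.aemeasurable (h2m.mul (measurable_response_val t)).aestronglyMeasurable,
      integral_map (f := fun z => D.indicator 1 (trunc t z.1, z.2) * G t z.1 z.2)
        hpair.aemeasurable (h2m.mul (hG.measurable t)).aestronglyMeasurable] at this
    rw [← integral_indicator (hm _ hA), ← integral_indicator (hm _ hA)]
    refine Eq.trans ?_ (this.symm.trans ?_) <;>
    · refine integral_congr_ae (Eventually.of_forall fun ω => ?_)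
      by_cases hω : ((trunc t fun s => Y s ω, fun s => X s ω) : (ℤ → Fin 2) × (ℤ → S)) ∈ D <;>
        simp [Set.indicator, hω]
  · rw [hGtr]
    exact ((hG.measurable t).comp (measurable_trunc_pair Y X t)).stronglyMeasurable.aestronglyMeasurable

end Solution

/-! ### Comparing an arbitrary solution with the causal one. -/

/-- For a stationary sequence, the mean of a function of the time-`t` state does not depend
on `t`. -/
lemma integral_stationary_eq {α : Type*} [MeasurableSpace α] {π : Measure α} {T : α → α}
    (hT : MeasurePreserving T π π) {a : ℤ → α → ℝ} (ha : ∀ t, Measurable (a t))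
    (haT : ∀ t x, a t (T x) = a (t + 1) x) (t : ℤ) : ∫ x, a t x ∂π = ∫ x, a 0 x ∂π := by
  have h : ∀ t, ∫ x, a (t + 1) x ∂π = ∫ x, a t x ∂π := fun t => by
    conv_rhs => rw [← hT.map_eq]
    rw [integral_map hT.measurable.aemeasurable (ha t).aestronglyMeasurable]
    simp only [haT]
  induction t using Int.induction_on with
  | zero => rfl
  | succ i ih => rw [h, ih]
  | pred i ih => rw [← ih, ← h (-(i : ℤ) - 1), sub_add_cancel]

lemma min_one_add_le {a b : ℝ} (ha : 0 ≤ a) (hb : 0 ≤ b) :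
    min 1 (a + b) ≤ min 1 a + min 1 b := by
  rcases le_total 1 a with h | h
  · rw [min_eq_left h]
    have : 0 ≤ min 1 b := le_min zero_le_one hb
    exact (min_le_left _ _).trans (by linarith)
  · rcases le_total 1 b with h' | h'
    · rw [min_eq_left h']
      have : 0 ≤ min 1 a := le_min zero_le_one ha
      exact (min_le_left _ _).trans (by linarith)
    · rw [min_eq_right h, min_eq_right h']
      exact min_le_right _ _

lemma min_one_sum_le {ι : Type*} (s : Finset ι) {a : ι → ℝ} (ha : ∀ i ∈ s, 0 ≤ a i) :
    min 1 (∑ i ∈ s, a i) ≤ ∑ i ∈ s, min 1 (a i) := by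
  classical
  induction s using Finset.induction_on with
  | empty => simp
  | insert i s hi ih =>
    rw [Finset.sum_insert hi, Finset.sum_insert hi]
    have hs : ∀ j ∈ s, 0 ≤ a j := fun j hj => ha j (Finset.mem_insert_of_mem hj)
    exact (min_one_add_le (ha i (Finset.mem_insert_self _ _)) (Finset.sum_nonneg hs)).trans
      (by linarith [ih hs])

/-- A homogeneous solution that is dominated by a stationary sequence vanishes. -/
lemma ae_eq_zero_of_homogeneous {Ω : Type*} [MeasurableSpace Ω] {P : Measure Ω}
    [IsProbabilityMeasure P] {q : ℕ} {β : ℕ → ℝ} {C ρ : ℝ}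
    (hM : ∀ n i j, |(companion q β ^ n) i j| ≤ C * ρ ^ n) (hC : 0 ≤ C) (hρ0 : 0 < ρ) (hρ1 : ρ < 1)
    {D Z : ℤ → Ω → ℝ} (hD : ∀ t, Measurable (D t)) (hZ : ∀ t, Measurable (Z t))
    (hZ0 : ∀ t ω, 0 ≤ Z t ω)
    (hrec : ∀ᵐ ω ∂P, ∀ t, D t ω = ∑ j ∈ Finset.Icc 1 q, β j * D (t - (j : ℤ)) ω)
    (hDZ : ∀ᵐ ω ∂P, ∀ t, |D t ω| ≤ Z t ω) {B : ℝ → ℝ} (hB : Tendsto B (𝓝 0) (𝓝 0))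
    (hZB : ∀ t, ∀ a > 0, ∫ ω, min 1 (a * Z t ω) ∂P ≤ B a) (t : ℤ) :
    ∀ᵐ ω ∂P, D t ω = 0 := by
  have hmin : ∀ {W : Ω → ℝ}, Measurable W → (∀ ω, 0 ≤ W ω) →
      Integrable (fun ω => min 1 (W ω)) P := fun hW hW0 =>
    integrable_of_abs_le (measurable_const.min hW) (c := 1) fun ω => by
      rw [abs_of_nonneg (le_min zero_le_one (hW0 ω))]
      exact min_le_left _ _
  -- Truncation by `min 1` measures smallness in probability, so no moments of `Z` are needed. The
  -- factor `C + 1` keeps the scale positive when `C = 0`.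
  have hbound : ∀ n : ℕ, ∫ ω, min 1 |D t ω| ∂P ≤ (q + 1) * B ((C + 1) * ρ ^ n) := by
    intro n
    have ha : 0 < (C + 1) * ρ ^ n := by positivity
    have hi : ∀ j : Fin (q + 1), Integrable
        (fun ω => min 1 ((C + 1) * ρ ^ n * Z (t - n - (j : ℕ)) ω)) P := fun j =>
      hmin ((hZ _).const_mul _) fun ω => mul_nonneg ha.le (hZ0 _ _)
    calc ∫ ω, min 1 |D t ω| ∂P
        ≤ ∫ ω, ∑ j : Fin (q + 1), min 1 ((C + 1) * ρ ^ n * Z (t - n - (j : ℕ)) ω) ∂P := by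
          refine integral_mono_ae (hmin (hD t).abs fun _ => abs_nonneg _)
            (integrable_finsetSum _ fun j _ => hi j) ?_
          filter_upwards [hrec, hDZ] with ω h1 h2
          refine le_trans (min_le_min_left 1 ?_) (min_one_sum_le _ fun j _ =>
            mul_nonneg ha.le (hZ0 _ _))
          rw [← Finset.mul_sum]
          refine (homogeneous_bound hM h1 t n).trans ?_
          exact mul_le_mul (by gcongr; linarith) (Finset.sum_le_sum fun j _ => h2 _)
            (Finset.sum_nonneg fun _ _ => abs_nonneg _) ha.le
      _ = ∑ j : Fin (q + 1), ∫ ω, min 1 ((C + 1) * ρ ^ n * Z (t - n - (j : ℕ)) ω) ∂P :=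
          integral_finsetSum _ fun j _ => hi j
      _ ≤ ∑ _j : Fin (q + 1), B ((C + 1) * ρ ^ n) := Finset.sum_le_sum fun j _ => hZB _ _ ha
      _ = _ := by simp
  have hlim : Tendsto (fun n : ℕ => ((q : ℝ) + 1) * B ((C + 1) * ρ ^ n)) atTop (𝓝 0) := by
    have h1 : Tendsto (fun n : ℕ => (C + 1) * ρ ^ n) atTop (𝓝 0) := by
      simpa using (tendsto_pow_atTop_nhds_zero_of_lt_one hρ0.le hρ1).const_mul (C + 1)
    simpa using (hB.comp h1).const_mul ((q : ℝ) + 1)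
  have h0 : ∀ ω, 0 ≤ min 1 |D t ω| := fun ω => le_min zero_le_one (abs_nonneg _)
  have hzero : ∫ ω, min 1 |D t ω| ∂P = 0 :=
    le_antisymm (ge_of_tendsto' hlim hbound) (integral_nonneg h0)
  rw [integral_eq_zero_iff_of_nonneg h0 (hmin (hD t).abs fun _ => abs_nonneg _)] at hzero
  filter_upwards [hzero] with ω hω
  have hω' : min 1 |D t ω| = 0 := hω
  rcases min_choice 1 |D t ω| with h | h
  · rw [h] at hω'; exact absurd hω' one_ne_zero
  · rw [h] at hω'; exact abs_eq_zero.1 hω'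

section Compatible

lemma shift_iterate_apply {S : Type*} {G : ℤ → (ℤ → Fin 2) → (ℤ → S) → ℝ}
    (hshift : ∀ t y x, G t (shift y) (shift x) = G (t + 1) y x) (n : ℕ) :
    ∀ t y x, G t (shift^[n] y) (shift^[n] x) = G (t + n) y x := by
  induction n with
  | zero => simp
  | succ n ih =>
    intro t y x
    rw [Function.iterate_succ_apply, Function.iterate_succ_apply, ih, hshift]
    congr 1
    push_cast
    ring

variable {Ω : Type*} [MeasurableSpace Ω] {S : Type*} [MeasurableSpace S]
  {G : ℤ → (ℤ → Fin 2) → (ℤ → S) → ℝ} {P : Measure Ω} [IsProbabilityMeasure P]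
  {Y : ℤ → Ω → Fin 2} {X : ℤ → Ω → S}

lemma isCompatible_of_condExp (hG : IsEnvironmentTransition G) (hY : ∀ t, Measurable (Y t))
    (hX : ∀ t, Measurable (X t))
    (hk : ∀ t, P[Set.indicator {ω | Y t ω = 1} (fun _ => (1 : ℝ)) | pastAndCovariates Y X t]
      =ᵐ[P] fun ω => G t (fun s => Y s ω) (fun s => X s ω)) :
    IsCompatible G (P.map fun ω => (fun t => Y t ω, fun t => X t ω)) := by
  intro t h c hh hc
  have hpair := measurable_pair hY hX
  have hhm : Measurable fun z : (ℤ → Fin 2) × (ℤ → S) => h (trunc t z.1, z.2) :=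
    hh.comp (measurable_trunc_prod t)
  rw [integral_map (f := fun z => h (trunc t z.1, z.2) * ((z.1 t : ℕ) : ℝ))
      hpair.aemeasurable (hhm.mul (measurable_response_val t)).aestronglyMeasurable,
    integral_map (f := fun z => h (trunc t z.1, z.2) * G t z.1 z.2)
      hpair.aemeasurable (hhm.mul (hG.measurable t)).aestronglyMeasurable]
  exact integral_mul_of_condExp hY hX (hk t) hh hc

/-- If responses and covariates are jointly stationary, conditional probabilities that approach a
stationary family of transition probabilities must be given by this family. -/
lemma isCompatible_of_stationary (hG : IsEnvironmentTransition G)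
    (hshift : ∀ t y x, G t (shift y) (shift x) = G (t + 1) y x) (hY : ∀ t, Measurable (Y t))
    (hX : ∀ t, Measurable (X t))
    (hT : MeasurePreserving (Prod.map shift shift)
      (P.map fun ω => ((fun t => Y t ω, fun t => X t ω) : (ℤ → Fin 2) × (ℤ → S)))
      (P.map fun ω => ((fun t => Y t ω, fun t => X t ω) : (ℤ → Fin 2) × (ℤ → S))))
    {k : ℤ → Ω → ℝ} (hkm : ∀ t, Measurable (k t)) (hk1 : ∀ t ω, |k t ω| ≤ 1)
    (hk : ∀ t, P[Set.indicator {ω | Y t ω = 1} (fun _ => (1 : ℝ)) | pastAndCovariates Y X t]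
      =ᵐ[P] k t)
    (hlim : ∀ᵐ ω ∂P, ∀ t : ℤ, Tendsto (fun n : ℕ => k (t + n) ω
      - G (t + n) (fun s => Y s ω) (fun s => X s ω)) atTop (𝓝 0)) :
    IsCompatible G (P.map fun ω => (fun t => Y t ω, fun t => X t ω)) := by
  intro t h c hh hc
  set Q := P.map fun ω => ((fun t => Y t ω, fun t => X t ω) : (ℤ → Fin 2) × (ℤ → S)) with hQ
  have hpair := measurable_pair hY hX
  have hc0 : ∀ ω : Ω, 0 ≤ c := fun ω => (abs_nonneg _).trans (hc (fun s => Y s ω, fun s => X s ω))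
  have hTn : ∀ (n : ℕ) (z : (ℤ → Fin 2) × (ℤ → S)),
      (Prod.map shift shift)^[n] z = (shift^[n] z.1, shift^[n] z.2) := fun n z => by
    rw [Prod.map_iterate]; rfl
  have htr : ∀ (n : ℕ) (y : ℤ → Fin 2), trunc t (shift^[n] y) = shift^[n] (trunc (t + n) y) := by
    intro n y
    funext r
    simp [trunc, shift_iterate]
  set h' : ℕ → (ℤ → Fin 2) × (ℤ → S) → ℝ := fun n z => h ((Prod.map shift shift)^[n] z) with hh'
  have hh'm : ∀ n, Measurable (h' n) := fun n => hh.comp (hT.iterate n).measurable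
  have hhm : ∀ s n, Measurable fun z : (ℤ → Fin 2) × (ℤ → S) => h' n (trunc s z.1, z.2) :=
    fun s n => (hh'm n).comp (measurable_trunc_prod s)
  have transfer : ∀ (n : ℕ) {a b : (ℤ → Fin 2) × (ℤ → S) → ℝ}, Measurable a → Measurable b →
      (∀ z, a ((Prod.map shift shift)^[n] z) = b z) →
      ∫ z, h (trunc t z.1, z.2) * a z ∂Q
        = ∫ ω, h' n (trunc (t + n) fun s => Y s ω, fun s => X s ω)
          * b (fun s => Y s ω, fun s => X s ω) ∂P := by
    intro n a b ha hb hab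
    have hn := hT.iterate n
    rw [← hn.map_eq, integral_map (f := fun z => h (trunc t z.1, z.2) * a z)
      hn.measurable.aemeasurable ((hhm t 0).mul ha).aestronglyMeasurable]
    have : ∀ z : (ℤ → Fin 2) × (ℤ → S),
        h (trunc t ((Prod.map shift shift)^[n] z).1, ((Prod.map shift shift)^[n] z).2)
          * a ((Prod.map shift shift)^[n] z) = h' n (trunc (t + n) z.1, z.2) * b z := by
      intro z
      rw [hab]
      simp only [hh', hTn, htr]
    simp only [this]
    rw [hQ, integral_map (f := fun z => h' n (trunc (t + n) z.1, z.2) * b z)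
      hpair.aemeasurable ((hhm (t + n) n).mul hb).aestronglyMeasurable]
  have hbd : ∀ (n : ℕ) {a : Ω → ℝ}, Measurable a → (∀ ω, |a ω| ≤ 1) → Integrable
      (fun ω => h' n (trunc (t + n) fun s => Y s ω, fun s => X s ω) * a ω) P := by
    intro n a ha ha1
    refine integrable_of_abs_le (((hhm (t + n) n).comp hpair).mul ha) (c := c) fun ω => ?_
    rw [abs_mul]
    exact (mul_le_of_le_one_right (abs_nonneg _) (ha1 ω)).trans (hc _)
  have hG1 : ∀ s ω, |G s (fun s => Y s ω) (fun s => X s ω)| ≤ 1 := fun s ω =>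
    abs_le.2 ⟨by linarith [hG.nonneg s (fun s => Y s ω) (fun s => X s ω)], hG.le_one _ _ _⟩
  have hGm : ∀ s, Measurable fun ω => G s (fun s => Y s ω) (fun s => X s ω) := fun s =>
    (hG.measurable s).comp hpair
  -- Stationarity carries the compatibility defect from time `t` to `t + n`, where it is an average
  -- against `k - G`. The left side is free of `n`, so it must vanish.
  have hdiff : ∀ n : ℕ, ∫ z, h (trunc t z.1, z.2) * ((z.1 t : ℕ) : ℝ) ∂Q
      - ∫ z, h (trunc t z.1, z.2) * G t z.1 z.2 ∂Q
      = ∫ ω, h' n (trunc (t + n) fun s => Y s ω, fun s => X s ω)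
          * (k (t + n) ω - G (t + n) (fun s => Y s ω) (fun s => X s ω)) ∂P := by
    intro n
    rw [transfer n (measurable_response_val t) (measurable_response_val (t + n))
        (fun z => by rw [hTn]; dsimp only; rw [shift_iterate]),
      transfer n (hG.measurable t) (hG.measurable (t + n))
        (fun z => by rw [hTn]; exact shift_iterate_apply hshift n t z.1 z.2),
      integral_mul_of_condExp hY hX (hk (t + n)) (hh'm n) (fun z => hc _),
      ← integral_sub (hbd n (hkm _) (hk1 _)) (hbd n (hGm _) (hG1 _))]
    simp only [mul_sub]
  have hconv : Tendsto (fun n : ℕ => ∫ ω, h' n (trunc (t + n) fun s => Y s ω, fun s => X s ω)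
      * (k (t + n) ω - G (t + n) (fun s => Y s ω) (fun s => X s ω)) ∂P) atTop
      (𝓝 (∫ _, (0 : ℝ) ∂P)) := by
    refine tendsto_integral_of_dominated_convergence (fun _ => c * 2)
      (fun n => (((hhm (t + n) n).comp hpair).mul
        ((hkm _).sub (hGm _))).aestronglyMeasurable) (integrable_const _)
      (fun n => Eventually.of_forall fun ω => ?_) ?_
    · rw [Real.norm_eq_abs, abs_mul]
      refine mul_le_mul (hc _) ?_ (abs_nonneg _) (hc0 ω)
      have h1 := abs_le.1 (hk1 (t + n) ω)
      have h2 := abs_le.1 (hG1 (t + n) ω)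
      rw [abs_le]
      constructor <;> linarith
    · filter_upwards [hlim] with ω hω
      have := ((hω t).abs).const_mul c
      rw [abs_zero, mul_zero] at this
      refine squeeze_zero_norm (fun n => ?_) this
      rw [Real.norm_eq_abs, abs_mul]
      exact mul_le_mul_of_nonneg_right (hc _) (abs_nonneg _)
  rw [integral_zero] at hconv
  simp only [← hdiff] at hconv
  exact sub_eq_zero.1 (tendsto_nhds_unique tendsto_const_nhds hconv)

end Compatible

/-! ### The autoregressive model. -/

section Model

variable {d : ℕ} {q p : ℕ} {β α : ℕ → ℝ} {γ : EuclideanSpace ℝ (Fin d)} {F : ℝ → ℝ}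

lemma measurable_latent_pair (t : ℤ) :
    Measurable fun z : (ℤ → Fin 2) × (ℤ → EuclideanSpace ℝ (Fin d)) =>
      latent q p β α γ t z.1 z.2 := by
  have hY : ∀ s < t, Measurable
      fun z : (ℤ → Fin 2) × (ℤ → EuclideanSpace ℝ (Fin d)) => z.1 s :=
    fun s _ => (measurable_pi_apply s).comp measurable_fst
  have hX : ∀ s, Measurable
      fun z : (ℤ → Fin 2) × (ℤ → EuclideanSpace ℝ (Fin d)) => z.2 s :=
    fun s => (measurable_pi_apply s).comp measurable_snd
  exact measurable_latent hY hX

lemma isEnvironmentTransition_latent (hFm : Measurable F) (h0 : ∀ x, 0 ≤ F x)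
    (h1 : ∀ x, F x ≤ 1) :
    IsEnvironmentTransition fun t y x => F (latent q p β α γ t y x) where
  measurable t := hFm.comp (measurable_latent_pair t)
  nonneg _ _ _ := h0 _
  le_one _ _ _ := h1 _
  dependsOn t x y y' hy := by
    have : latent q p β α γ t y x = latent q p β α γ t y' x := by
      refine tsum_congr fun n => ?_
      unfold input
      congr 2
      refine Finset.sum_congr rfl fun k hk => ?_
      rw [hy]
      have := (Finset.mem_Icc.1 hk).1
      simp only [Set.mem_Iio]
      omega
    simp only [this]

variable {C ρ : ℝ}

lemma Tame.isTransition {L : NNReal} (hFL : LipschitzWith L F) (h0 : ∀ x, 0 ≤ F x)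
    (h1 : ∀ x, F x ≤ 1) (hM : ∀ n i j, |(companion q β ^ n) i j| ≤ C * ρ ^ n)
    (hC : 0 ≤ C) (hρ0 : 0 < ρ) (hρ1 : ρ < 1) {x : ℤ → EuclideanSpace ℝ (Fin d)}
    (hx : Tame ρ x) :
    IsTransition (fun t y => F (latent q p β α γ t y x))
      fun k => L * latentConst p α C ρ * √ρ ^ k where
  nonneg _ _ := h0 _
  le_one _ _ := h1 _
  osc t k y y' hy := by
    have := hFL.dist_le_mul (latent q p β α γ t y x) (latent q p β α γ t y' x)
    rw [Real.dist_eq, Real.dist_eq] at this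
    refine this.trans ?_
    rw [mul_assoc]
    exact mul_le_mul_of_nonneg_left (hx.osc_latent hM hC hρ0 hρ1 t k y y' hy) L.2

lemma exists_geometric_tail_le {a r : ℝ} (ha : 0 ≤ a) (hr0 : 0 ≤ r) (hr1 : r < 1) :
    ∃ m : ℕ, ∀ j, ∑ i ∈ Finset.range j, a * r ^ (m + i) ≤ 1 / 2 := by
  have hlim : Tendsto (fun m : ℕ => a * (1 - r)⁻¹ * r ^ m) atTop (𝓝 0) := by
    simpa using (tendsto_pow_atTop_nhds_zero_of_lt_one hr0 hr1).const_mul (a * (1 - r)⁻¹)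
  obtain ⟨m, hm⟩ := (hlim.eventually (ge_mem_nhds (show (0 : ℝ) < 1 / 2 by norm_num))).exists
  refine ⟨m, fun j => le_trans ?_ hm⟩
  have hgeo : ∑ i ∈ Finset.range j, r ^ i ≤ (1 - r)⁻¹ := by
    rw [← tsum_geometric_of_lt_one hr0 hr1]
    exact (summable_geometric_of_lt_one hr0 hr1).sum_le_tsum _ fun i _ => by positivity
  calc ∑ i ∈ Finset.range j, a * r ^ (m + i) = a * r ^ m * ∑ i ∈ Finset.range j, r ^ i := by
        rw [Finset.mul_sum]
        exact Finset.sum_congr rfl fun i _ => by rw [pow_add]; ring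
    _ ≤ a * r ^ m * (1 - r)⁻¹ := mul_le_mul_of_nonneg_left hgeo (by positivity)
    _ = _ := by ring

/-- In almost every environment, the model forgets its past. -/
theorem ae_forgets {π : Measure (ℤ → EuclideanSpace ℝ (Fin d))} [IsProbabilityMeasure π]
    (hπ : MeasurePreserving shift π π) {L : NNReal} (hFL : LipschitzWith L F) (hFmono : Monotone F)
    (hpos : ∀ x, 0 < F x) (h1 : ∀ x, F x ≤ 1)
    (hM : ∀ n i j, |(companion q β ^ n) i j| ≤ C * ρ ^ n)
    (hC : 0 ≤ C) (hρ0 : 0 < ρ) (hρ1 : ρ < 1) (htame : ∀ᵐ x ∂π, Tame ρ x) :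
    ∀ᵐ x ∂π, (∀ t, Continuous fun y => F (latent q p β α γ t y x)) ∧
      Forgets fun t y => F (latent q p β α γ t y x) := by
  have hr1 : √ρ < 1 := by rw [Real.sqrt_lt' one_pos]; simpa using hρ1
  have hK := latentConst_nonneg (p := p) (α := α) hC hρ1
  have ha : 0 ≤ (L : ℝ) * latentConst p α C ρ := mul_nonneg L.2 hK
  obtain ⟨m, hm⟩ := exists_geometric_tail_le ha (Real.sqrt_nonneg ρ) hr1
  have hb : Tendsto (fun k : ℕ => (L : ℝ) * latentConst p α C ρ * √ρ ^ k) atTop (𝓝 0) := by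
    simpa using (tendsto_pow_atTop_nhds_zero_of_lt_one (Real.sqrt_nonneg ρ) hr1).const_mul
      ((L : ℝ) * latentConst p α C ρ)
  -- Changing the responses moves the latent value by at most `latentConst`. As `F` is monotone,
  -- this `η` is a lower bound valid for every past, and it is positive because `F` is.
  have hwin := ae_frequently_window hπ
    (η := fun t x => F (latent q p β α γ t 0 x - latentConst p α C ρ))
    (fun t => hFL.continuous.measurable.comp
      (((measurable_latent_pair t).comp (measurable_const.prodMk measurable_id)).sub_const _))
    (fun t x => by
      have := latent_shift (q := q) (p := p) (β := β) (α := α) (γ := γ) t 0 x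
      rw [← this]
      rfl) (fun t x => hpos _) m
  filter_upwards [hwin, htame] with x hx hxt
  have htr := hxt.isTransition (p := p) (α := α) (γ := γ) hFL (fun x => (hpos x).le) h1 hM hC
    hρ0 hρ1
  refine ⟨fun t => hFL.continuous.comp (continuous_of_osc (t := t) fun ε hε => ?_), ?_⟩
  · have hlim : Tendsto (fun k : ℕ => latentConst p α C ρ * √ρ ^ k) atTop (𝓝 0) := by
      simpa using (tendsto_pow_atTop_nhds_zero_of_lt_one (Real.sqrt_nonneg ρ) hr1).const_mul
        (latentConst p α C ρ)
    obtain ⟨k, hk⟩ := (hlim.eventually (ge_mem_nhds hε)).exists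
    exact ⟨k, (hxt.osc_latent hM hC hρ0 hρ1 t k).mono le_rfl hk⟩
  · intro N f w hw hf
    refine back_osc_tendsto htr hb hm ?_ hw hf
    obtain ⟨δ, hδ, hδw⟩ := hx
    refine ⟨δ, hδ, fun T => ?_⟩
    obtain ⟨s, hs, hsw⟩ := hδw T
    refine ⟨s, hs, fun r hr1 hr2 y => (hsw r hr1 hr2).trans (hFmono ?_)⟩
    have := hxt.osc_latent (p := p) (α := α) (γ := γ) hM hC hρ0 hρ1 r 0 0 y (by intro i; omega)
    rw [pow_zero, mul_one] at this
    linarith [(abs_le.1 this).2]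

variable {Ω : Type*} [MeasurableSpace Ω] {P : Measure Ω}
  {X : ℤ → Ω → EuclideanSpace ℝ (Fin d)} {Y : ℤ → Ω → Fin 2} {μ : ℤ → Ω → ℝ}

/-- Two solutions of the recursion differ by a solution of the homogeneous recursion. -/
lemma IsSolution.ae_homogeneous (hsol : IsSolution F q p β α γ P X Y μ)
    (hM : ∀ n i j, |(companion q β ^ n) i j| ≤ C * ρ ^ n)
    (hρ0 : 0 < ρ) (hρ1 : ρ < 1) (htame : ∀ᵐ ω ∂P, Tame ρ fun s => X s ω) :
    ∀ᵐ ω ∂P, ∀ t, μ t ω - latent q p β α γ t (fun s => Y s ω) (fun s => X s ω)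
      = ∑ j ∈ Finset.Icc 1 q, β j * (μ (t - (j : ℤ)) ω
        - latent q p β α γ (t - (j : ℤ)) (fun s => Y s ω) (fun s => X s ω)) := by
  filter_upwards [ae_all_iff.2 hsol.recursion, htame] with ω h1 h2 t
  rw [h1 t, h2.latent_recursion hM hρ0 hρ1 (fun s => Y s ω) t]
  simp only [mul_sub, Finset.sum_sub_distrib]
  ring

lemma IsSolution.measurable_pair (hsol : IsSolution F q p β α γ P X Y μ) :
    Measurable fun ω => ((fun t => Y t ω, fun t => X t ω) :
      (ℤ → Fin 2) × (ℤ → EuclideanSpace ℝ (Fin d))) :=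
  BinaryAutoregression.measurable_pair hsol.measurable_response hsol.measurable_covariate

/-- Here `μ` need not equal `latent`, but their difference solves the homogeneous recursion and
decays geometrically as time goes to `+∞`. As `F` is Lipschitz, the conditional probabilities
approach those of the chain. -/
lemma IsSolution.isCompatible_of_stationary_pair [IsProbabilityMeasure P]
    (hsol : IsSolution F q p β α γ P X Y μ)
    {L : NNReal} (hFL : LipschitzWith L F) (h0 : ∀ x, 0 ≤ F x) (h1 : ∀ x, F x ≤ 1)
    (hM : ∀ n i j, |(companion q β ^ n) i j| ≤ C * ρ ^ n)
    (hρ0 : 0 < ρ) (hρ1 : ρ < 1) (htame : ∀ᵐ ω ∂P, Tame ρ fun s => X s ω)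
    (hstat : IsStationary P fun t ω => (Y t ω, X t ω)) :
    IsCompatible (fun t y x => F (latent q p β α γ t y x))
      (P.map fun ω => (fun t => Y t ω, fun t => X t ω)) := by
  have hpair := hsol.measurable_pair
  have hzip : Measurable fun ω => fun t => (Y t ω, X t ω) := measurable_pi_lambda _ hstat.1
  have hunzip : Measurable fun z : ℤ → Fin 2 × EuclideanSpace ℝ (Fin d) =>
      ((fun t => (z t).1, fun t => (z t).2) :
        (ℤ → Fin 2) × (ℤ → EuclideanSpace ℝ (Fin d))) :=
    (measurable_pi_lambda _ fun t => (measurable_pi_apply t).fst).prodMk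
      (measurable_pi_lambda _ fun t => (measurable_pi_apply t).snd)
  have hT : MeasurePreserving (Prod.map shift shift)
      (P.map fun ω => ((fun t => Y t ω, fun t => X t ω) :
        (ℤ → Fin 2) × (ℤ → EuclideanSpace ℝ (Fin d))))
      (P.map fun ω => ((fun t => Y t ω, fun t => X t ω) :
        (ℤ → Fin 2) × (ℤ → EuclideanSpace ℝ (Fin d)))) := by
    have hmp : MeasurePreserving (fun z : ℤ → Fin 2 × EuclideanSpace ℝ (Fin d) =>
        ((fun t => (z t).1, fun t => (z t).2) :
          (ℤ → Fin 2) × (ℤ → EuclideanSpace ℝ (Fin d)))) (law P fun t ω => (Y t ω, X t ω))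
        (P.map fun ω => (fun t => Y t ω, fun t => X t ω)) := by
      refine ⟨hunzip, ?_⟩
      rw [law, Measure.map_map hunzip hzip]
      rfl
    exact hmp.of_semiconj hstat.2 (fun _ => rfl) measurable_shift_prod
  refine isCompatible_of_stationary
    (isEnvironmentTransition_latent hFL.continuous.measurable h0 h1)
    (fun t y x => by rw [latent_shift]) hsol.measurable_response hsol.measurable_covariate hT
    (k := fun t ω => F (μ t ω))
    (fun t => hFL.continuous.measurable.comp (hsol.measurable_latent t))
    (fun t ω => abs_le.2 ⟨by linarith [h0 (μ t ω)], h1 _⟩) hsol.condProb ?_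
  filter_upwards [hsol.ae_homogeneous hM hρ0 hρ1 htame] with ω hω t
  set D : ℤ → ℝ := fun t => μ t ω - latent q p β α γ t (fun s => Y s ω) (fun s => X s ω) with hD
  have hbound : ∀ n : ℕ, |D (t + n)| ≤ C * ρ ^ n * ∑ j : Fin (q + 1), |D (t - (j : ℕ))| := by
    intro n
    simpa using homogeneous_bound hM hω (t + n) n
  have hlim : Tendsto (fun n : ℕ => (L : ℝ) * (C * ρ ^ n * ∑ j : Fin (q + 1), |D (t - (j : ℕ))|))
      atTop (𝓝 0) := by
    simpa using (((tendsto_pow_atTop_nhds_zero_of_lt_one hρ0.le hρ1).const_mul C).mul_const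
      (∑ j : Fin (q + 1), |D (t - (j : ℕ))|)).const_mul (L : ℝ)
  refine squeeze_zero_norm (fun n => ?_) hlim
  have := hFL.dist_le_mul (μ (t + n) ω)
    (latent q p β α γ (t + n) (fun s => Y s ω) (fun s => X s ω))
  rw [Real.dist_eq, Real.dist_eq] at this
  exact this.trans (mul_le_mul_of_nonneg_left (hbound n) L.2)

lemma tendsto_integral_min_one {Ω : Type*} [MeasurableSpace Ω] (P : Measure Ω)
    [IsProbabilityMeasure P] {W : Ω → ℝ} (hW : Measurable W) :
    Tendsto (fun a : ℝ => ∫ ω, min 1 (|a| * |W ω|) ∂P) (𝓝 0) (𝓝 0) := by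
  have : Tendsto (fun a : ℝ => ∫ ω, min 1 (|a| * |W ω|) ∂P) (𝓝 0) (𝓝 (∫ _, (0 : ℝ) ∂P)) := by
    refine tendsto_integral_filter_of_dominated_convergence (fun _ => 1)
      (Eventually.of_forall fun a =>
        (measurable_const.min (hW.abs.const_mul _)).aestronglyMeasurable)
      (Eventually.of_forall fun a => Eventually.of_forall fun ω => ?_) (integrable_const _)
      (Eventually.of_forall fun ω => ?_)
    · rw [Real.norm_eq_abs, abs_of_nonneg (le_min zero_le_one (by positivity))]
      exact min_le_left _ _
    · have hc : Continuous fun a : ℝ => min 1 (|a| * |W ω|) := by fun_prop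
      simpa using hc.tendsto 0
  simpa using this

/-- The homogeneous solution `μ - latent` is tight uniformly in time, and hence zero. Neither `Y`
nor the triple is known to be stationary, so `Y` is replaced by `0` at the bounded cost `K`; the
terms in `μ` and in `X` are each stationary, and subadditivity of `min 1` treats them separately. -/
lemma IsSolution.latent_eq_of_stationary [IsProbabilityMeasure P]
    (hsol : IsSolution F q p β α γ P X Y μ)
    (hM : ∀ n i j, |(companion q β ^ n) i j| ≤ C * ρ ^ n) (hC : 0 ≤ C)
    (hρ0 : 0 < ρ) (hρ1 : ρ < 1) (htame : ∀ᵐ ω ∂P, Tame ρ fun s => X s ω)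
    (hX : MeasurePreserving shift (law P X) (law P X)) (hstat : IsStationary P μ) :
    ∀ᵐ ω ∂P, ∀ t, μ t ω = latent q p β α γ t (fun s => Y s ω) (fun s => X s ω) := by
  have hXm : Measurable fun ω => fun t => X t ω := measurable_pi_lambda _ hsol.measurable_covariate
  have hμm : Measurable fun ω => fun t => μ t ω := measurable_pi_lambda _ hsol.measurable_latent
  have hlat : ∀ t, Measurable fun x : ℤ → EuclideanSpace ℝ (Fin d) => latent q p β α γ t 0 x :=
    fun t => BinaryAutoregression.measurable_latent (Y := fun _ _ => 0) (fun _ _ => measurable_const)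
      fun s => measurable_pi_apply s
  have hl0 : ∀ t, Measurable fun ω => latent q p β α γ t 0 (fun s => X s ω) :=
    fun t => (hlat t).comp hXm
  have hlm : ∀ t, Measurable fun ω => latent q p β α γ t (fun s => Y s ω) (fun s => X s ω) :=
    fun t => BinaryAutoregression.measurable_latent (fun s _ => hsol.measurable_response s)
      hsol.measurable_covariate
  set K := latentConst p α C ρ with hK
  have hK0 : 0 ≤ K := latentConst_nonneg hC hρ1
  have hlim : Tendsto (fun a : ℝ => ∫ ω, min 1 (|a| * |μ 0 ω|) ∂P
      + ∫ ω, min 1 (|a| * |latent q p β α γ 0 0 (fun s => X s ω)|) ∂P + |a| * K)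
      (𝓝 0) (𝓝 0) := by
    have h3 : Tendsto (fun a : ℝ => |a| * K) (𝓝 0) (𝓝 0) := by
      have hc : Continuous fun a : ℝ => |a| * K := by fun_prop
      simpa using hc.tendsto 0
    simpa using ((tendsto_integral_min_one P (hsol.measurable_latent 0)).add
      (tendsto_integral_min_one P (hl0 0))).add h3
  refine ae_all_iff.2 fun t => ?_
  have := ae_eq_zero_of_homogeneous (P := P) hM hC hρ0 hρ1
    (D := fun t ω => μ t ω - latent q p β α γ t (fun s => Y s ω) (fun s => X s ω))
    (Z := fun t ω => |μ t ω| + |latent q p β α γ t 0 (fun s => X s ω)| + K)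
    (fun t => (hsol.measurable_latent t).sub (hlm t))
    (fun t => ((hsol.measurable_latent t).abs.add (hl0 t).abs).add_const K)
    (fun t ω => by positivity) (hsol.ae_homogeneous hM hρ0 hρ1 htame) ?_ hlim ?_ t
  · filter_upwards [this] with ω hω
    exact sub_eq_zero.1 hω
  · filter_upwards [htame] with ω hω t
    have h1 := hω.osc_latent (p := p) (α := α) (γ := γ) hM hC hρ0 hρ1 t 0 0 (fun s => Y s ω)
      (by intro i; omega)
    rw [pow_zero, mul_one, ← hK] at h1
    have h2 := abs_le.1 h1
    have h3 := abs_le.1 (le_refl |μ t ω|)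
    have h4 := abs_le.1 (le_refl |latent q p β α γ t 0 (fun s => X s ω)|)
    rw [abs_le]
    constructor <;> linarith
  · intro t a ha
    have hint : ∀ {W : Ω → ℝ}, Measurable W → Integrable (fun ω => min 1 (|a| * |W ω|)) P :=
      fun hW => integrable_of_abs_le (measurable_const.min (hW.abs.const_mul _)) (c := 1)
        fun ω => by
          rw [abs_of_nonneg (le_min zero_le_one (by positivity))]
          exact min_le_left _ _
    have e1 : ∫ ω, min 1 (|a| * |μ t ω|) ∂P = ∫ ω, min 1 (|a| * |μ 0 ω|) ∂P := by
      have hm : ∀ t : ℤ, Measurable fun z : ℤ → ℝ => min 1 (|a| * |z t|) := fun t =>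
        measurable_const.min ((measurable_pi_apply t).abs.const_mul _)
      have := integral_stationary_eq hstat.2 (a := fun t z => min 1 (|a| * |z t|)) hm
        (fun _ _ => rfl) t
      rwa [law, integral_map hμm.aemeasurable (hm t).aestronglyMeasurable,
        integral_map hμm.aemeasurable (hm 0).aestronglyMeasurable] at this
    have e2 : ∫ ω, min 1 (|a| * |latent q p β α γ t 0 (fun s => X s ω)|) ∂P
        = ∫ ω, min 1 (|a| * |latent q p β α γ 0 0 (fun s => X s ω)|) ∂P := by
      have hm : ∀ t : ℤ, Measurable fun x : ℤ → EuclideanSpace ℝ (Fin d) =>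
          min 1 (|a| * |latent q p β α γ t 0 x|) := fun t =>
        measurable_const.min ((hlat t).abs.const_mul _)
      have := integral_stationary_eq hX
        (a := fun t x => min 1 (|a| * |latent q p β α γ t 0 x|)) hm
        (fun t x => by
          have := latent_shift (q := q) (p := p) (β := β) (α := α) (γ := γ) t 0 x
          rw [← this]
          rfl) t
      rwa [law, integral_map hXm.aemeasurable (hm t).aestronglyMeasurable,
        integral_map hXm.aemeasurable (hm 0).aestronglyMeasurable] at this
    rw [← e1, ← e2, ← integral_add (hint (hsol.measurable_latent t)) (hint (hl0 t))]
    have hconst : |a| * K = ∫ _, |a| * K ∂P := by simp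
    have hi2 : Integrable (fun ω => min 1 (|a| * |μ t ω|)
        + min 1 (|a| * |latent q p β α γ t 0 (fun s => X s ω)|)) P :=
      (hint (hsol.measurable_latent t)).add (hint (hl0 t))
    rw [hconst, ← integral_add hi2 (integrable_const _)]
    refine integral_mono_of_nonneg (Eventually.of_forall fun ω =>
      le_min zero_le_one (by positivity)) (hi2.add (integrable_const _))
      (Eventually.of_forall fun ω => ?_)
    have hb1 := min_one_add_le (a := a * (|μ t ω| + |latent q p β α γ t 0 (fun s => X s ω)|))
      (b := a * K) (by positivity) (by positivity)
    have hb2 := min_one_add_le (a := a * |μ t ω|)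
      (b := a * |latent q p β α γ t 0 (fun s => X s ω)|) (by positivity) (by positivity)
    rw [← mul_add] at hb1 hb2
    simp only [abs_of_pos ha]
    refine hb1.trans ?_
    linarith [min_le_right 1 (a * K)]

end Model

/-! ### Joint laws as images of the law of responses and covariates. -/

section Joint

variable {d : ℕ} {q p : ℕ} {β α : ℕ → ℝ} {γ : EuclideanSpace ℝ (Fin d)}

/-- Joins two sequences into a sequence of pairs. -/
def zipSeq {S S' : Type*} (z : (ℤ → S) × (ℤ → S')) : ℤ → S × S' := fun t => (z.1 t, z.2 t)

lemma measurable_zipSeq {S S' : Type*} [MeasurableSpace S] [MeasurableSpace S'] :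
    Measurable (zipSeq : (ℤ → S) × (ℤ → S') → ℤ → S × S') :=
  measurable_pi_lambda _ fun t => ((measurable_pi_apply t).comp measurable_fst).prodMk
    ((measurable_pi_apply t).comp measurable_snd)

variable (q p β α γ) in
/-- Adjoins the latent process to the responses and the covariates. -/
noncomputable def adjoinLatent (z : (ℤ → Fin 2) × (ℤ → EuclideanSpace ℝ (Fin d))) :
    ℤ → Fin 2 × EuclideanSpace ℝ (Fin d) × ℝ :=
  fun t => (z.1 t, z.2 t, latent q p β α γ t z.1 z.2)

lemma measurable_adjoinLatent : Measurable (adjoinLatent q p β α γ) :=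
  measurable_pi_lambda _ fun t => ((measurable_pi_apply t).comp measurable_fst).prodMk
    (((measurable_pi_apply t).comp measurable_snd).prodMk (measurable_latent_pair t))

lemma adjoinLatent_shift (z : (ℤ → Fin 2) × (ℤ → EuclideanSpace ℝ (Fin d))) :
    adjoinLatent q p β α γ (Prod.map shift shift z) = shift (adjoinLatent q p β α γ z) := by
  funext t
  simp only [adjoinLatent, Prod.map_fst, Prod.map_snd, latent_shift]
  rfl

variable {Ω : Type*} [MeasurableSpace Ω] {P : Measure Ω}
  {X : ℤ → Ω → EuclideanSpace ℝ (Fin d)} {Y : ℤ → Ω → Fin 2} {μ : ℤ → Ω → ℝ}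

lemma law_pair (hY : ∀ t, Measurable (Y t)) (hX : ∀ t, Measurable (X t)) :
    law P (fun t ω => (Y t ω, X t ω))
      = (P.map fun ω => ((fun t => Y t ω, fun t => X t ω) :
        (ℤ → Fin 2) × (ℤ → EuclideanSpace ℝ (Fin d)))).map zipSeq := by
  rw [Measure.map_map measurable_zipSeq (measurable_pair hY hX)]
  rfl

lemma law_triple (hY : ∀ t, Measurable (Y t)) (hX : ∀ t, Measurable (X t))
    (hμ : ∀ᵐ ω ∂P, ∀ t, μ t ω = latent q p β α γ t (fun s => Y s ω) (fun s => X s ω)) :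
    law P (fun t ω => (Y t ω, X t ω, μ t ω))
      = (P.map fun ω => ((fun t => Y t ω, fun t => X t ω) :
        (ℤ → Fin 2) × (ℤ → EuclideanSpace ℝ (Fin d)))).map (adjoinLatent q p β α γ) := by
  rw [Measure.map_map measurable_adjoinLatent (measurable_pair hY hX)]
  refine Measure.map_congr ?_
  filter_upwards [hμ] with ω hω
  funext t
  simp [adjoinLatent, hω t]

lemma map_snd_pair (hY : ∀ t, Measurable (Y t)) (hX : ∀ t, Measurable (X t)) :
    (P.map fun ω => ((fun t => Y t ω, fun t => X t ω) :
      (ℤ → Fin 2) × (ℤ → EuclideanSpace ℝ (Fin d)))).map Prod.snd = law P X := by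
  rw [Measure.map_map measurable_snd (measurable_pair hY hX)]
  rfl

end Joint

end BinaryAutoregression

/-! ### The main theorem. -/

open BinaryAutoregression

theorem proposition2 {d : ℕ}
    -- the cumulative distribution function `F`
    (ν : Measure ℝ) [IsProbabilityMeasure ν] (F : ℝ → ℝ) (hF : ∀ x, F x = cdf ν x)
    (hF_pos : ∀ x, 0 < F x) (hF_lip : ∃ L, LipschitzWith L F)
    -- the parameters of the recursion
    (q p : ℕ) (β α : ℕ → ℝ) (γ : EuclideanSpace ℝ (Fin d))
    (hβ : ∀ z : ℂ, 1 - ∑ j ∈ Finset.Icc 1 q, (β j : ℂ) * z ^ j = 0 → 1 < ‖z‖)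
    -- the covariate process `X`
    {Ω₀ : Type u} [MeasurableSpace Ω₀] (P₀ : Measure Ω₀) [IsProbabilityMeasure P₀]
    (X : ℤ → Ω₀ → EuclideanSpace ℝ (Fin d))
    (hX : BinaryAutoregression.IsStationaryErgodic P₀ X)
    (hX_log : Integrable (fun ω => Real.posLog ‖X 1 ω‖) P₀) :
    -- existence, on an enlargement `{0,1}^ℤ × Ω₀` of the probability space carrying `X`,
    -- where `Y` is the coordinate process
    ∃ (P : Measure ((ℤ → Fin 2) × Ω₀)) (μ : ℤ → (ℤ → Fin 2) × Ω₀ → ℝ),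
      IsProbabilityMeasure P ∧ P.map Prod.snd = P₀ ∧
      BinaryAutoregression.IsSolution F q p β α γ P
        (fun t ω => X t ω.2) (fun t ω => ω.1 t) μ ∧
      BinaryAutoregression.IsStationary P (fun t ω => (ω.1 t, X t ω.2, μ t ω)) ∧
      BinaryAutoregression.IsStationaryErgodic P (fun t ω => (ω.1 t, X t ω.2)) ∧
      -- uniqueness in law, among solutions on all probability spaces
      ∀ (Ω' : Type v) [MeasurableSpace Ω'] (P' : Measure Ω') [IsProbabilityMeasure P']
        (X' : ℤ → Ω' → EuclideanSpace ℝ (Fin d)) (Y' : ℤ → Ω' → Fin 2) (μ' : ℤ → Ω' → ℝ),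
        BinaryAutoregression.law P' X' = BinaryAutoregression.law P₀ X →
        BinaryAutoregression.IsSolution F q p β α γ P' X' Y' μ' →
        (BinaryAutoregression.IsStationary P' (fun t ω => (Y' t ω, X' t ω)) →
          BinaryAutoregression.law P' (fun t ω => (Y' t ω, X' t ω)) =
            BinaryAutoregression.law P (fun t ω => (ω.1 t, X t ω.2))) ∧
        (BinaryAutoregression.IsStationary P' μ' →
          BinaryAutoregression.law P' (fun t ω => (Y' t ω, X' t ω, μ' t ω)) =
            BinaryAutoregression.law P (fun t ω => (ω.1 t, X t ω.2, μ t ω))) := by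
  obtain ⟨L, hFL⟩ := hF_lip
  have hF0 : ∀ x, 0 ≤ F x := fun x => (hF_pos x).le
  have hF1 : ∀ x, F x ≤ 1 := fun x => by rw [hF]; exact cdf_le_one ν x
  have hFmono : Monotone F := fun x y hxy => by rw [hF, hF]; exact monotone_cdf ν hxy
  obtain ⟨C, ρ, hC, hρ0, hρ1, hM⟩ := exists_companion_pow_le hβ
  have hG := isEnvironmentTransition_latent (q := q) (p := p) (β := β) (α := α) (γ := γ)
    hFL.continuous.measurable hF0 hF1
  have hshift : ∀ t y x, F (latent q p β α γ t (shift y) (shift x))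
      = F (latent q p β α γ (t + 1) y x) := fun t y x => by rw [latent_shift]
  obtain ⟨hXm, hXerg⟩ := hX
  have hXmap : Measurable fun ω => fun t => X t ω := measurable_pi_lambda _ hXm
  have hπp : IsProbabilityMeasure (law P₀ X) :=
    Measure.isProbabilityMeasure_map hXmap.aemeasurable
  have htame : ∀ᵐ x ∂(law P₀ X), Tame ρ x := by
    refine ae_tame hXerg.toMeasurePreserving ?_ hρ0 hρ1
    have hm : Measurable fun x : ℤ → EuclideanSpace ℝ (Fin d) => Real.posLog ‖x 1‖ := by
      have : Measurable Real.posLog := measurable_const.max Real.measurable_log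
      exact this.comp (measurable_pi_apply (1 : ℤ)).norm
    exact (integrable_map_measure hm.aestronglyMeasurable hXmap.aemeasurable).2 hX_log
  have hgood := ae_forgets (p := p) (α := α) (γ := γ) hXerg.toMeasurePreserving hFL hFmono hF_pos
    hF1 hM hC hρ0 hρ1 htame
  have hforget := hgood.mono fun x hx => hx.2
  obtain ⟨P, hP, hPsnd, hPc⟩ := exists_compatible P₀ hXmap hG hgood
  have hYm : ∀ t, Measurable fun ω : (ℤ → Fin 2) × Ω₀ => ω.1 t := fun t =>
    (measurable_pi_apply t).comp measurable_fst
  have hXm' : ∀ t, Measurable fun ω : (ℤ → Fin 2) × Ω₀ => X t ω.2 := fun t =>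
    (hXm t).comp measurable_snd
  set μ : ℤ → (ℤ → Fin 2) × Ω₀ → ℝ := fun t ω => latent q p β α γ t ω.1 (fun s => X s ω.2) with hμ
  set Q : Measure ((ℤ → Fin 2) × (ℤ → EuclideanSpace ℝ (Fin d))) :=
    P.map fun ω => (fun t => ω.1 t, fun t => X t ω.2) with hQdef
  have hpair : Measurable fun ω : (ℤ → Fin 2) × Ω₀ =>
      ((fun t => ω.1 t, fun t => X t ω.2) : (ℤ → Fin 2) × (ℤ → EuclideanSpace ℝ (Fin d))) :=
    measurable_pair hYm hXm'
  have hQp : IsProbabilityMeasure Q := Measure.isProbabilityMeasure_map hpair.aemeasurable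
  have hQc : IsCompatible (fun t y x => F (latent q p β α γ t y x)) Q := hPc
  have hlaw : law P (fun t ω => X t ω.2) = law P₀ X := by
    conv_rhs => rw [law, ← hPsnd, Measure.map_map hXmap measurable_snd]
    rfl
  have hQsnd : Q.map Prod.snd = law P₀ X := (map_snd_pair hYm hXm').trans hlaw
  have hQerg : Ergodic (Prod.map shift shift) Q :=
    hQc.ergodic hG hshift (by rwa [hQsnd]) (by rwa [hQsnd])
  have htameP : ∀ᵐ ω ∂P, Tame ρ fun s => X s ω.2 := by
    rw [← hlaw] at htame
    exact ae_of_ae_map (measurable_pi_lambda _ hXm').aemeasurable htame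
  have hμm : ∀ t, Measurable (μ t) := fun t => measurable_latent (fun s _ => hYm s) hXm'
  have htriple : law P (fun t ω => (ω.1 t, X t ω.2, μ t ω)) = Q.map (adjoinLatent q p β α γ) :=
    law_triple hYm hXm' (Eventually.of_forall fun ω t => rfl)
  have hpairlaw : law P (fun t ω => (ω.1 t, X t ω.2)) = Q.map zipSeq := law_pair hYm hXm'
  refine ⟨P, μ, hP, hPsnd, ⟨hXm', hYm, hμm, fun t => ?_, fun t => ?_⟩, ⟨fun t => ?_, ?_⟩,
    ⟨fun t => ?_, ?_⟩, ?_⟩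
  · filter_upwards [htameP] with ω hω
    exact hω.latent_recursion hM hρ0 hρ1 ω.1 t
  · exact condExp_of_isCompatible hYm hXm' hG hQc t
  · exact (hYm t).prodMk ((hXm' t).prodMk (hμm t))
  · rw [htriple]
    exact (measurable_adjoinLatent.measurePreserving Q).of_semiconj hQerg.toMeasurePreserving
      adjoinLatent_shift measurable_shift
  · exact (hYm t).prodMk (hXm' t)
  · rw [hpairlaw]
    exact (measurable_zipSeq.measurePreserving Q).ergodic_of_ergodic_semiconj hQerg
      measurable_shift fun _ => rfl
  · intro Ω' _ P' _ X' Y' μ' hlaw' hsol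
    have hY' := hsol.measurable_response
    have hX' := hsol.measurable_covariate
    have htame' : ∀ᵐ ω ∂P', Tame ρ fun s => X' s ω := by
      rw [← hlaw'] at htame
      exact ae_of_ae_map (measurable_pi_lambda _ hX').aemeasurable htame
    -- Both uniqueness claims reduce to compatibility of the law of `(Y', X')`; in the second,
    -- stationarity of `μ'` first identifies it with `latent`.
    have huniq : IsCompatible (fun t y x => F (latent q p β α γ t y x))
        (P'.map fun ω => (fun t => Y' t ω, fun t => X' t ω)) →
        (P'.map fun ω => (fun t => Y' t ω, fun t => X' t ω)) = Q := fun hc => by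
      have : IsProbabilityMeasure (P'.map fun ω => ((fun t => Y' t ω, fun t => X' t ω) :
          (ℤ → Fin 2) × (ℤ → EuclideanSpace ℝ (Fin d)))) :=
        Measure.isProbabilityMeasure_map (measurable_pair hY' hX').aemeasurable
      have hsnd := (map_snd_pair (P := P') hY' hX').trans hlaw'
      exact hc.unique hQc hG (hsnd.trans hQsnd.symm) (by rwa [hsnd])
    refine ⟨fun hstat => ?_, fun hstat => ?_⟩
    · rw [law_pair hY' hX', hpairlaw,
        huniq (hsol.isCompatible_of_stationary_pair hFL hF0 hF1 hM hρ0 hρ1 htame' hstat)]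
    · have hlat := hsol.latent_eq_of_stationary hM hC hρ0 hρ1 htame'
        (hlaw' ▸ hXerg.toMeasurePreserving) hstat
      rw [law_triple hY' hX' hlat, htriple, huniq (isCompatible_of_condExp hG hY' hX' fun t => ?_)]
      filter_upwards [hsol.condProb t, hlat] with ω h1 h2
      rw [h1, h2 t]
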